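/- Let $K$ be a field, $e=(e_1,\dots,e_k)$ a vector of non-negative integers, $a\ge 2$ and $b\ge 0$. The rational normal scroll with degrees $e$ has coordinates $z^{(i)}_j$ ($1\le i\le k$, $0\le j\le e_i$). It is given by the $2\times2$ minors of the matrix with the columns $(z^{(i)}_j,\,z^{(i)}_{j+1})$, $0\le j<e_i$, and is parametrised by $z^{(i)}_j=z^{(i)}s^{e_i-j}t^j$. Write $\langle e,I\rangle=\sum_l e_l i_l$ and $|I|=\sum_l i_l$ for $I=(i_1,\dots,i_k)\in\mathbb Z_{\ge0}^k$, let $\delta_l$ be the $l$-th unit vector, and let $$P=\sum_{|I|=a}\ \sum_{j=0}^{\langle e,I\rangle-b}p_{I,j}\,s^{\langle e,I\rangle-b-j}t^jz^I\neq 0$$ be the equation of a divisor of type $aH-bR$ (the inner sum is empty if $\langle e,I\rangle<b$). Let $P_0,\dots,P_b$ be rolling-factors equations for $P$: forms of degree $a$ in the $z^{(i)}_j$ such that $P_m$ becomes $s^{b-m}t^mP$ under the parametrisation, and such that for $0\le m<b$ there are polynomials $p_{\alpha,m}$, indexed by the columns $\alpha$ of the matrix, with $P_m=\sum_\alpha p_{\alpha,m}z_\alpha$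 and $P_{m+1}=\sum_\alpha p_{\alpha,m}z_{\alpha+1}$, where $(z_\alpha,z_{\alpha+1})$ is the column $\alpha$. Let $\zeta=(\zeta^{(i)}_j)_{0<j<e_i}$ with $\zeta^{(i)}_j\in K$, and put $\zeta^{(i)}_j=0$ for all other $j$. It gives the first-order deformation of the (cone over the) scroll over $K[\varepsilon]$, $\varepsilon^2=0$, defined by the minors of the matrix with the columns $(z^{(i)}_j,\,z^{(i)}_{j+1}+\varepsilon\zeta^{(i)}_{j+1})$. A lift of $\zeta$ is a family of forms $P'_0,\dots,P'_b$ of degree $a-1$ in the $z^{(i)}_j$ such that the quotient of $K[\varepsilon][z^{(i)}_j]$ by these minors and the $P_m+\varepsilon P'_m$ is flat over $K[\varepsilon]$. It is a rolling-factors lift if, moreover, $P_0+\varepsilon P_0',\dots,P_b+\varepsilon P'_b$ are in rolling-factors form with respect to the deformed matrix, that is, for each $0\le m<b$ the equations number $m$ and $m+1$ are combinations, with the same coefficients, of the top row and of the bottom row, respectively. Consider the linear equations $$\sum_{l=1}^k\ \sum_{j=0}^{\langle e,I+\delta_l\rangle-b}(i_l+1)\,p_{I+\delta_l,j}\,\zeta^{(l)}_{j+n}=0\qquad(|I|=a-1,\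 \langle e,I\rangle<b-1,\ 0<n<b-\langle e,I\rangle).\tag{L}$$ 1. $\zeta$ has a rolling-factors lift if and only if all equations (L) hold. 2. Suppose that it is not the case that exactly one $e_i$ is positive and $z^{(i)}$ divides $P$ for this $i$. Then $\zeta$ has a lift if and only if all equations (L) hold. 3. The system (L) has as coefficient matrix the *lifting matrix*, whose rows are indexed by the pairs $(I,n)$ as in (L) and whose columns are indexed by the variables $\zeta^{(l)}_c$, $0<c<e_l$; its entry is $(i_l+1)p_{I+\delta_l,\,c-n}$ if $0\le c-n\le\langle e,I+\delta_l\rangle-b$, and $0$ otherwise. -/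

import Mathlib

noncomputable section

namespace RollingFactors

/-- Coordinates `z^{(i)}_j`, `0 ≤ j ≤ e_i`, of the ambient projective space of the scroll with
degrees `e = (e_1, …, e_k)`; degrees `e_i = 0` are allowed. -/
abbrev ScrollVar {k : ℕ} (e : Fin k → ℕ) : Type := Σ i : Fin k, Fin (e i + 1)

/-- Columns of the scroll matrix: pairs `(i, j)` with `0 ≤ j < e_i`, the column being
`(z^{(i)}_j, z^{(i)}_{j+1})`. -/
abbrev ScrollCol {k : ℕ} (e : Fin k → ℕ) : Type := Σ i : Fin k, Fin (e i)

/-- The `2 × ∑ e_i` matrix with columns `(z^{(i)}_j, z^{(i)}_{j+1} + c^{(i)}_{j+1})`.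
For `c = 0` this is the matrix of the scroll itself. -/
def scrollMatrix {k : ℕ} (e : Fin k → ℕ) {A : Type*} [CommRing A] (c : Fin k → ℕ → A) :
    Matrix (Fin 2) (ScrollCol e) (MvPolynomial (ScrollVar e) A) :=
  Matrix.of ![fun α => MvPolynomial.X ⟨α.1, α.2.castSucc⟩,
    fun α => MvPolynomial.X ⟨α.1, α.2.succ⟩ + MvPolynomial.C (c α.1 ((α.2 : ℕ) + 1))]

/-- The ideal generated by the `2 × 2` minors of a matrix with two rows. -/
def minorIdeal {S C : Type*} [CommRing S] (M : Matrix (Fin 2) C S) : Ideal S :=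
  Ideal.span {f | ∃ α β : C, f = M 0 α * M 1 β - M 1 α * M 0 β}

/-- The equations `Q_0, …, Q_b` are in rolling factors format with respect to a matrix `M` with
two rows: each `Q_m` is a combination of the top row, and `Q_{m+1}` is the same combination of the
bottom row. -/
def IsRolling {S C : Type*} [CommRing S] [Fintype C] (M : Matrix (Fin 2) C S) {b : ℕ}
    (Q : Fin (b + 1) → S) : Prop :=
  ∀ m : Fin b, ∃ q : C → S,
    Q m.castSucc = ∑ α, q α * M 0 α ∧ Q m.succ = ∑ α, q α * M 1 α

/-- The bihomogeneous coordinate ring `K[s, t, z^{(1)}, …, z^{(k)}]` of the `ℙ^{k-1}`-bundle over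
`ℙ¹` which resolves the scroll. -/
abbrev CoxRing (K : Type*) [CommRing K] (k : ℕ) : Type _ := MvPolynomial (Fin 2 ⊕ Fin k) K

/-- The coordinate `s` of the base `ℙ¹`. -/
def sVar (K : Type*) [CommRing K] (k : ℕ) : CoxRing K k := MvPolynomial.X (Sum.inl 0)

/-- The coordinate `t` of the base `ℙ¹`. -/
def tVar (K : Type*) [CommRing K] (k : ℕ) : CoxRing K k := MvPolynomial.X (Sum.inl 1)

/-- The fibre coordinate `z^{(i)}`. -/
def zVar (K : Type*) [CommRing K] {k : ℕ} (i : Fin k) : CoxRing K k := MvPolynomial.X (Sum.inr i)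

/-- The parametrisation `z^{(i)}_j = z^{(i)} s^{e_i - j} t^j` of the scroll. -/
def param (K : Type*) [CommRing K] {k : ℕ} (e : Fin k → ℕ) :
    MvPolynomial (ScrollVar e) K →ₐ[K] CoxRing K k :=
  MvPolynomial.aeval fun v =>
    zVar K v.1 * sVar K k ^ (e v.1 - (v.2 : ℕ)) * tVar K k ^ (v.2 : ℕ)

/-- `⟨e, I⟩ = ∑ e_l i_l`. -/
def pairing {k : ℕ} (e I : Fin k → ℕ) : ℕ := ∑ l, e l * I l

/-- The general bihomogeneous equation of a divisor of type `aH - bR`,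
`P = ∑_{|I| = a} ∑_{j = 0}^{⟨e,I⟩ - b} p_{I,j} s^{⟨e,I⟩-b-j} t^j z^I`.
The range of `j` is empty when `⟨e,I⟩ < b`. -/
def divisorEq {K : Type*} [CommRing K] {k : ℕ} (e : Fin k → ℕ) (a b : ℕ)
    (p : (Fin k → ℕ) → ℕ → K) : CoxRing K k :=
  ∑ I ∈ Finset.piAntidiag (Finset.univ : Finset (Fin k)) a,
    ∑ j ∈ Finset.range (pairing e I + 1 - b),
      MvPolynomial.C (p I j) * sVar K k ^ (pairing e I - b - j) * tVar K k ^ j *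
        ∏ l, zVar K l ^ I l

/-- `P_0, …, P_b` are rolling factors equations of the divisor `P` of type `aH - bR`: forms of
degree `a` in the coordinates `z^{(i)}_j`, in rolling factors format with respect to the scroll
matrix, `P_m` representing `s^{b-m} t^m P`. -/
structure IsRollingEquations {K : Type*} [CommRing K] {k : ℕ} (e : Fin k → ℕ) (a b : ℕ)
    (P : CoxRing K k) (Pm : Fin (b + 1) → MvPolynomial (ScrollVar e) K) : Prop where
  homogeneous : ∀ m, (Pm m).IsHomogeneous a
  rolling : IsRolling (scrollMatrix e (0 : Fin k → ℕ → K)) Pm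
  represents : ∀ m, param K e (Pm m) = sVar K k ^ (b - (m : ℕ)) * tVar K k ^ (m : ℕ) * P

/-- The first-order perturbation `F + ε F'`, a polynomial over the dual numbers `K[ε]`. -/
def perturb {K σ : Type*} [CommRing K] (F F' : MvPolynomial σ K) :
    MvPolynomial σ (DualNumber K) :=
  MvPolynomial.map (algebraMap K (DualNumber K)) F +
    MvPolynomial.C DualNumber.eps * MvPolynomial.map (algebraMap K (DualNumber K)) F'

/-- The matrix of the first-order deformation of the scroll given by `ζ`: its columns are
`(z^{(i)}_j, z^{(i)}_{j+1} + ε ζ^{(i)}_{j+1})`. -/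
def deformedMatrix {K : Type*} [CommRing K] {k : ℕ} (e : Fin k → ℕ) (ζ : Fin k → ℕ → K) :
    Matrix (Fin 2) (ScrollCol e) (MvPolynomial (ScrollVar e) (DualNumber K)) :=
  scrollMatrix e fun i j => ζ i j • (DualNumber.eps : DualNumber K)

/-- The minors of the deformed scroll matrix together with the perturbed equations
`P_m + ε P_m'` define a first-order deformation, of degree `-1`, of the affine cone
defined by the minors of the scroll matrix and the `P_m`: the `P_m'` are forms of degree `a - 1`
and the quotient ring is flat over `K[ε]`. -/
def IsDeformation {K : Type*} [CommRing K] {k : ℕ} (e : Fin k → ℕ) (a : ℕ) {b : ℕ}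
    (ζ : Fin k → ℕ → K) (Pm Pm' : Fin (b + 1) → MvPolynomial (ScrollVar e) K) : Prop :=
  (∀ m, (Pm' m).IsHomogeneous (a - 1)) ∧
  Module.Flat (DualNumber K)
    (MvPolynomial (ScrollVar e) (DualNumber K) ⧸
      (minorIdeal (deformedMatrix e ζ) ⊔
        Ideal.span (Set.range fun m => perturb (Pm m) (Pm' m))))

/-- The first-order deformation `ζ` of the scroll lifts to a deformation of the subvariety given by
the additional equations `P_m`. -/
def Lifts {K : Type*} [CommRing K] {k : ℕ} (e : Fin k → ℕ) (a : ℕ) {b : ℕ}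
    (ζ : Fin k → ℕ → K) (Pm : Fin (b + 1) → MvPolynomial (ScrollVar e) K) : Prop :=
  ∃ Pm' : Fin (b + 1) → MvPolynomial (ScrollVar e) K, IsDeformation e a ζ Pm Pm'

/-- The first-order deformation `ζ` of the scroll lifts to a rolling factors deformation: a
deformation whose additional equations are in rolling factors format with respect to the matrix of
the deformed scroll. -/
def LiftsRolling {K : Type*} [CommRing K] {k : ℕ} (e : Fin k → ℕ) (a : ℕ) {b : ℕ}
    (ζ : Fin k → ℕ → K) (Pm : Fin (b + 1) → MvPolynomial (ScrollVar e) K) : Prop :=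
  ∃ Pm' : Fin (b + 1) → MvPolynomial (ScrollVar e) K, IsDeformation e a ζ Pm Pm' ∧
    IsRolling (deformedMatrix e ζ) fun m => perturb (Pm m) (Pm' m)

/-- The left hand side
`∑_l ∑_{j = 0}^{⟨e, I + δ_l⟩ - b} (i_l + 1) p_{I + δ_l, j} ζ^{(l)}_{j+n}`
of the lifting equation with index `(I, n)`. -/
def liftingForm {K : Type*} [CommRing K] {k : ℕ} (e : Fin k → ℕ) (b : ℕ)
    (p : (Fin k → ℕ) → ℕ → K) (ζ : Fin k → ℕ → K) (I : Fin k → ℕ) (n : ℕ) : K :=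
  ∑ l, ∑ j ∈ Finset.range (pairing e (I + Pi.single l 1) + 1 - b),
    ((I l : K) + 1) * p (I + Pi.single l 1) j * ζ l (j + n)

/-- Indices of the lifting equations. -/
abbrev LiftingRow {k : ℕ} (e : Fin k → ℕ) (a b : ℕ) : Type :=
  {r : (Fin k → ℕ) × ℕ //
    ∑ l, r.1 l = a - 1 ∧ pairing e r.1 < b - 1 ∧ 0 < r.2 ∧ r.2 < b - pairing e r.1}

/-- The deformation variables `ζ^{(l)}_c`, `0 < c < e_l`, indexed by `c - 1`. -/
abbrev LiftingCol {k : ℕ} (e : Fin k → ℕ) : Type := Σ l : Fin k, Fin (e l - 1)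

/-- The lifting matrix. The entry in the row `(I, n)` and the column of `ζ^{(l)}_c` is the
coefficient of this variable, that is, `(i_l + 1) p_{I + δ_l, j}` if `c = j + n` with `j` in the
range of summation, and zero otherwise. -/
def liftingMatrix {K : Type*} [CommRing K] {k : ℕ} (e : Fin k → ℕ) (a b : ℕ)
    (p : (Fin k → ℕ) → ℕ → K) : Matrix (LiftingRow e a b) (LiftingCol e) K :=
  Matrix.of fun r c =>
    ∑ j ∈ Finset.range (pairing e (r.1.1 + Pi.single c.1 1) + 1 - b),
      if j + r.1.2 = (c.2 : ℕ) + 1 then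
        ((r.1.1 c.1 : K) + 1) * p (r.1.1 + Pi.single c.1 1) j else 0

end RollingFactors

end

namespace RollingFactors

open MvPolynomial
open scoped TensorProduct

/-! The lifting equations say that a class in an H¹ of line bundles on ℙ¹ vanishes, computed by a
Čech cocycle for the two charts s ≠ 0 and t ≠ 0 inside the polynomial ring K[s, t, z]. In each chart
the parametrisation extends to the deformed scroll: with t/s invertible or not, the bottom row can
be solved from the top row starting at z_0, or the top row from the bottom row starting at z_e.
Denominators are cleared by sending ε to s^M ε or t^M ε (`chart`, `chartS`, `chartT`). The two
extensions differ by a vertical vector field E = ∑ g_l ∂/∂z^{(l)} (`derivAlong_chartT_sub_chartS`).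

A deformation of the divisor means deformations P + εh and P + εh' in the two charts that agree
after gluing, that is, E(P) = s^M h' − t^M h. This is solvable exactly when E(P) has no monomial s^x
t^y z^I with x, y < M, and the coefficients at these monomials are the lifting forms
(`coeff_fibreDeriv_divisorEq`).

Sufficiency (`exists_deformation`): from h and h' one solves for P'_m in both charts simultaneously;
the result has weight zero, so it comes from a polynomial in the scroll coordinates. Flatness
(`flat_of_charts`) holds because an element f with εf in the deformed ideal becomes a multiple of P
in each chart, hence globally; since the scroll ideal is generated by the minors, f lies in the
undeformed ideal and the relation lifts.

Necessity (`liftingForm_eq_zero_of_chart`): if the deformed equations still satisfy s·P_{m+1} =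
t·P_m in the chart t ≠ 0, then s^b t^b E(P) is a combination of s^{b+M} and t^{b+M}, and the
forbidden coefficients vanish. For rolling lifts the relation is immediate. For an arbitrary flat
lift it follows from the syzygies x_α P_{m+1} − y_α P_m = ∑ q_β · minor: flatness makes the defect
w, of degree a − 1 in the z^{(i)}, a multiple of P up to a monomial factor, and P has degree a, so w
= 0 (`exists_row_mul_eq`, `eq_zero_of_row_mul_eq`). The monomial factor contains z^{(i)}, which is
harmless except in the excluded case. -/

/-! ### Flatness over the dual numbers. -/

theorem exists_eq_tmul_of_principal {A M : Type*} [CommRing A] [AddCommGroup M] [Module A M] (g : A)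
    (x : (Ideal.span {g} : Ideal A) ⊗[A] M) :
    ∃ m : M, x = (⟨g, Ideal.mem_span_singleton_self g⟩ : (Ideal.span {g} : Ideal A)) ⊗ₜ[A] m := by
  induction x using TensorProduct.induction_on with
  | zero => exact ⟨0, by simp⟩
  | tmul r m =>
    obtain ⟨r, hr⟩ := r
    obtain ⟨c, rfl⟩ := Ideal.mem_span_singleton'.1 hr
    refine ⟨c • m, ?_⟩
    rw [← TensorProduct.smul_tmul]
    rfl
  | add x y hx hy =>
    obtain ⟨m, rfl⟩ := hx
    obtain ⟨n, rfl⟩ := hy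
    exact ⟨m + n, by rw [TensorProduct.tmul_add]⟩

/-- A module over the dual numbers of a field is flat if and only if every element killed by `ε`
is a multiple of `ε`. -/
theorem flat_dualNumber_iff {K M : Type*} [Field K] [AddCommGroup M] [Module (DualNumber K) M] :
    Module.Flat (DualNumber K) M ↔
      ∀ x : M, (DualNumber.eps : DualNumber K) • x = 0 →
        ∃ y, x = (DualNumber.eps : DualNumber K) • y := by
  constructor
  · intro _ x hx
    -- Equational criterion for the single relation ε x = 0: x = ∑ a_j y_j with ε a_j = 0, and the
    -- annihilator of ε is (ε).
    obtain ⟨κ, a, y, hxy, ha⟩ := Module.Flat.isTrivialRelation_of_sum_smul_eq_zero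
      (ι := Unit) (f := fun _ => (DualNumber.eps : DualNumber K)) (x := fun _ => x) (by simpa using hx)
    have ha' : ∀ j, ∃ c, a () j = DualNumber.eps * c := by
      intro j
      have h := congrArg TrivSqZeroExt.snd (ha j)
      have h0 : (a () j).fst = 0 := by simpa using h
      exact DualNumber.fst_eq_zero_iff_eps_dvd.1 h0
    choose c hc using ha'
    refine ⟨∑ j, c j • y j, ?_⟩
    refine (hxy ()).trans ?_
    rw [Finset.smul_sum]
    exact Finset.sum_congr rfl fun j _ => by rw [hc j, mul_smul]
  · intro h
    rw [Module.Flat.iff_lift_lsmul_comp_subtype_injective]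
    rintro I -
    -- The only ideals are 0, (ε) and (1), all principal, so every element of I ⊗ M is a pure tensor
    -- g ⊗ m.
    obtain ⟨g, rfl, hg⟩ : ∃ g : DualNumber K, I = Ideal.span {g} ∧
        ∀ m : M, g • m = 0 →
          (⟨g, Ideal.mem_span_singleton_self g⟩ : (Ideal.span {g} : Ideal (DualNumber K)))
            ⊗ₜ[DualNumber K] m = 0 := by
      rcases DualNumber.ideal_trichotomy I with rfl | rfl | rfl
      · refine ⟨0, by simp, fun m _ => ?_⟩
        convert! TensorProduct.zero_tmul _ m
      · refine ⟨_, rfl, fun m hm => ?_⟩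
        obtain ⟨y, rfl⟩ := h m hm
        rw [← TensorProduct.smul_tmul]
        have h0 : (DualNumber.eps : DualNumber K) •
            (⟨DualNumber.eps, Ideal.mem_span_singleton_self _⟩ :
              (Ideal.span {DualNumber.eps} : Ideal (DualNumber K))) = 0 :=
          Subtype.ext (by simp)
        rw [h0, TensorProduct.zero_tmul]
      · refine ⟨1, by simp, fun m hm => ?_⟩
        rw [one_smul] at hm
        rw [hm, TensorProduct.tmul_zero]
    rw [injective_iff_map_eq_zero]
    intro x hx
    obtain ⟨m, rfl⟩ := exists_eq_tmul_of_principal g x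
    exact hg m (by simpa using hx)

/-! ### Calculus of first-order perturbations F + εF'. -/

section Perturb

variable {K σ : Type*} [CommRing K]

/-- Reduction of polynomials over the dual numbers modulo `ε`. -/
noncomputable def redEps (K σ : Type*) [CommRing K] : MvPolynomial σ (DualNumber K) →+* MvPolynomial σ K :=
  MvPolynomial.map (TrivSqZeroExt.fstHom K K K).toRingHom

theorem redEps_X (v : σ) : redEps K σ (X v) = X v := by simp [redEps]

theorem redEps_C (x : DualNumber K) : redEps K σ (C x) = C x.fst := by simp [redEps]

theorem redEps_perturb (F F' : MvPolynomial σ K) : redEps K σ (perturb F F') = F := by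
  have h : ∀ G : MvPolynomial σ K,
      redEps K σ (MvPolynomial.map (algebraMap K (DualNumber K)) G) = G := by
    intro G
    rw [redEps, MvPolynomial.map_map]
    convert MvPolynomial.map_id G
    ext x
    simp
  rw [perturb, map_add, map_mul, h, h, redEps_C]
  simp

theorem perturb_add (F F' G G' : MvPolynomial σ K) :
    perturb (F + G) (F' + G') = perturb F F' + perturb G G' := by
  simp only [perturb, map_add]; ring

theorem C_eps_mul_C_eps :
    (C DualNumber.eps * C DualNumber.eps : MvPolynomial σ (DualNumber K)) = 0 := by
  rw [← C_mul, DualNumber.eps_mul_eps, C_0]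

theorem perturb_mul (F F' G G' : MvPolynomial σ K) :
    perturb F F' * perturb G G' = perturb (F * G) (F * G' + F' * G) := by
  simp only [perturb, map_add, map_mul]
  linear_combination (MvPolynomial.map (algebraMap K (DualNumber K)) F' *
    MvPolynomial.map (algebraMap K (DualNumber K)) G') * C_eps_mul_C_eps (K := K) (σ := σ)

theorem perturb_sum {ι : Type*} (s : Finset ι) (F F' : ι → MvPolynomial σ K) :
    perturb (∑ i ∈ s, F i) (∑ i ∈ s, F' i) = ∑ i ∈ s, perturb (F i) (F' i) := by
  simp only [perturb, map_sum, Finset.mul_sum, Finset.sum_add_distrib]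

theorem exists_eq_perturb (F : MvPolynomial σ (DualNumber K)) :
    ∃ F' : MvPolynomial σ K, F = perturb (redEps K σ F) F' := by
  induction F using MvPolynomial.induction_on with
  | C x =>
    refine ⟨C x.snd, ?_⟩
    rw [redEps_C, perturb, map_C, map_C, ← C_mul, ← C_add]
    congr 1
    ext <;> simp [TrivSqZeroExt.algebraMap_eq_inl]
  | add F G hF hG =>
    obtain ⟨F', hF⟩ := hF
    obtain ⟨G', hG⟩ := hG
    refine ⟨F' + G', ?_⟩
    rw [map_add, perturb_add, ← hF, ← hG]
  | mul_X F v hF =>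
    obtain ⟨F', hF⟩ := hF
    refine ⟨F' * X v, ?_⟩
    conv_lhs => rw [hF]
    simp [perturb, redEps_X]
    ring

theorem perturb_zero_left (F' : MvPolynomial σ K) :
    perturb 0 F' = C DualNumber.eps * MvPolynomial.map (algebraMap K (DualNumber K)) F' := by
  simp [perturb]

end Perturb

/-! ### The scroll as a toric variety: its ideal is generated by the minors. -/

section Toric

variable {k : ℕ} (e : Fin k → ℕ)

/-- The exponent of the monomial `z^{(i)} s^{e_i - j} t^j`. -/
noncomputable def varExp (v : ScrollVar e) : Fin 2 ⊕ Fin k →₀ ℕ :=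
  Finsupp.single (Sum.inl 0) (e v.1 - (v.2 : ℕ)) + Finsupp.single (Sum.inl 1) (v.2 : ℕ) +
    Finsupp.single (Sum.inr v.1) 1

/-- The action of the parametrisation on exponents. -/
noncomputable def paramExp : (ScrollVar e →₀ ℕ) →ₗ[ℕ] (Fin 2 ⊕ Fin k →₀ ℕ) :=
  Finsupp.linearCombination ℕ (varExp e)

theorem varExp_s (v : ScrollVar e) : varExp e v (Sum.inl 0) = e v.1 - (v.2 : ℕ) := by
  simp [varExp]

theorem varExp_t (v : ScrollVar e) : varExp e v (Sum.inl 1) = (v.2 : ℕ) := by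
  simp [varExp]

theorem varExp_z (v : ScrollVar e) (i : Fin k) :
    varExp e v (Sum.inr i) = if v.1 = i then 1 else 0 := by
  simp [varExp, Finsupp.single_apply]

theorem paramExp_single (v : ScrollVar e) : paramExp e (Finsupp.single v 1) = varExp e v := by
  simp [paramExp]

theorem paramExp_apply (d : ScrollVar e →₀ ℕ) (x : Fin 2 ⊕ Fin k) :
    paramExp e d x = ∑ v, d v * varExp e v x := by
  rw [paramExp, Finsupp.linearCombination_apply, Finsupp.sum_fintype _ _ (by simp)]
  simp [Finsupp.finsetSum_apply]

theorem param_X (K : Type*) [CommRing K] (v : ScrollVar e) :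
    param K e (X v) = zVar K v.1 * sVar K k ^ (e v.1 - (v.2 : ℕ)) * tVar K k ^ (v.2 : ℕ) := by
  simp [param]

theorem param_monomial {K : Type*} [CommRing K] (d : ScrollVar e →₀ ℕ) (c : K) :
    param K e (monomial d c) = monomial (paramExp e d) c := by
  rw [param, aeval_monomial, paramExp, Finsupp.linearCombination_apply,
    monomial_finsupp_sum_index]
  congr 1
  refine Finsupp.prod_congr fun v _ => ?_
  have h : zVar K v.1 * sVar K k ^ (e v.1 - (v.2 : ℕ)) * tVar K k ^ (v.2 : ℕ) =
      monomial (varExp e v) 1 := by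
    rw [zVar, sVar, tVar, X_pow_eq_monomial, X_pow_eq_monomial, X, monomial_mul, monomial_mul,
      varExp, mul_one, mul_one]
    congr 2
    abel
  rw [h, monomial_pow, one_pow]

theorem exists_mem_of_paramExp_ne_zero {d : ScrollVar e →₀ ℕ} {x : Fin 2 ⊕ Fin k}
    (h : paramExp e d x ≠ 0) :
    ∃ v d₀, d = Finsupp.single v 1 + d₀ ∧ varExp e v x ≠ 0 := by
  rw [paramExp_apply] at h
  obtain ⟨v, -, hv⟩ := Finset.exists_ne_zero_of_sum_ne_zero h
  have hv' := mul_ne_zero_iff.1 hv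
  refine ⟨v, d - Finsupp.single v 1, ?_, hv'.2⟩
  rw [add_comm, tsub_add_cancel_of_le]
  rw [Finsupp.single_le_iff]
  omega

theorem minor_mem (K : Type*) [CommRing K] (α β : ScrollCol e) :
    X ⟨α.1, α.2.castSucc⟩ * X ⟨β.1, β.2.succ⟩ - X ⟨α.1, α.2.succ⟩ * X ⟨β.1, β.2.castSucc⟩ ∈
      minorIdeal (scrollMatrix e (0 : Fin k → ℕ → K)) :=
  Ideal.subset_span ⟨α, β, by simp [scrollMatrix]⟩

theorem exchange_mem (K : Type*) [CommRing K] (α β : ScrollCol e) (d : ScrollVar e →₀ ℕ) :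
    monomial (Finsupp.single (⟨α.1, α.2.castSucc⟩ : ScrollVar e) 1 +
        (Finsupp.single (⟨β.1, β.2.succ⟩ : ScrollVar e) 1 + d)) (1 : K) -
      monomial (Finsupp.single (⟨α.1, α.2.succ⟩ : ScrollVar e) 1 +
        (Finsupp.single (⟨β.1, β.2.castSucc⟩ : ScrollVar e) 1 + d)) (1 : K) ∈
      minorIdeal (scrollMatrix e (0 : Fin k → ℕ → K)) := by
  have h := Ideal.mul_mem_right (monomial d (1 : K)) _ (minor_mem e K α β)
  rw [sub_mul] at h
  simpa [X, monomial_mul, add_assoc] using h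

theorem varExp_exchange (α β : ScrollCol e) :
    varExp e ⟨α.1, α.2.castSucc⟩ + varExp e ⟨β.1, β.2.succ⟩ =
      varExp e ⟨α.1, α.2.succ⟩ + varExp e ⟨β.1, β.2.castSucc⟩ := by
  have h1 := α.2.2
  have h2 := β.2.2
  ext x
  rcases x with x | x
  · fin_cases x
    · simp [varExp_s]; omega
    · simp [varExp_t]; omega
  · simp [varExp_z]

/-- Modulo the minors a monomial divisible by `z^{(i)}_{j'}` can be rewritten as a multiple of
`z^{(i)}_j` if its image under the parametrisation allows it. -/
theorem exists_rewrite (K : Type*) [CommRing K] (i : Fin k) (j : Fin (e i + 1))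
    (d' : ScrollVar e →₀ ℕ) (n : ℕ) :
    ∀ (j' : Fin (e i + 1)) (d : ScrollVar e →₀ ℕ),
      ((j' : ℕ) - j) + ((j : ℕ) - j') = n →
      varExp e ⟨i, j'⟩ + paramExp e d = varExp e ⟨i, j⟩ + paramExp e d' →
      ∃ d₁, paramExp e d₁ = paramExp e d' ∧
        monomial (Finsupp.single (⟨i, j'⟩ : ScrollVar e) 1 + d) (1 : K) -
          monomial (Finsupp.single (⟨i, j⟩ : ScrollVar e) 1 + d₁) (1 : K) ∈
          minorIdeal (scrollMatrix e (0 : Fin k → ℕ → K)) := by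
  induction n with
  | zero =>
    intro j' d hn h
    obtain rfl : j' = j := Fin.ext (by omega)
    exact ⟨d, add_left_cancel h, by simp⟩
  | succ n ih =>
    intro j' d hn h
    rcases lt_or_ge (j' : ℕ) (j : ℕ) with hlt | hge
    -- Since j' < j, the exponent of t forces d to contain some variable of positive index; a minor
    -- raises j' by one and lowers that index by one. The other case is the mirror image with s.
    · have ht := DFunLike.congr_fun h (Sum.inl 1)
      simp only [Finsupp.add_apply, varExp_t] at ht
      obtain ⟨⟨i₂, j₂⟩, d₀, rfl, hv⟩ := exists_mem_of_paramExp_ne_zero e (d := d)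
        (x := Sum.inl 1) (by omega)
      rw [varExp_t] at hv
      simp only at hv
      obtain ⟨j₂, rfl⟩ := Fin.exists_succ_eq.2 (show j₂ ≠ 0 by rintro rfl; simp at hv)
      have hj' : (j' : ℕ) < e i := by have := j.2; omega
      let α : ScrollCol e := ⟨i, ⟨j', hj'⟩⟩
      let β : ScrollCol e := ⟨i₂, j₂⟩
      have hx := exchange_mem e K α β d₀
      have hα : (⟨α.1, α.2.castSucc⟩ : ScrollVar e) = ⟨i, j'⟩ := rfl
      have hex := varExp_exchange e α β
      obtain ⟨d₁, hd₁, hr⟩ := ih α.2.succ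
        (Finsupp.single (⟨β.1, β.2.castSucc⟩ : ScrollVar e) 1 + d₀)
        (by simp [α]; omega)
        (by
          rw [← h, map_add, map_add, paramExp_single, paramExp_single, ← add_assoc, ← add_assoc]
          exact congrArg (· + _) hex.symm)
      refine ⟨d₁, hd₁, ?_⟩
      have := add_mem hx hr
      rwa [sub_add_sub_cancel] at this
    · have hs := DFunLike.congr_fun h (Sum.inl 0)
      simp only [Finsupp.add_apply, varExp_s] at hs
      have hj'2 := j'.2
      obtain ⟨⟨i₂, j₂⟩, d₀, rfl, hv⟩ := exists_mem_of_paramExp_ne_zero e (d := d)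
        (x := Sum.inl 0) (by omega)
      rw [varExp_s] at hv
      simp only at hv
      obtain ⟨j₂, rfl⟩ := Fin.exists_castSucc_eq.2
        (show j₂ ≠ Fin.last _ by rintro rfl; simp at hv)
      obtain ⟨j', rfl⟩ := Fin.exists_succ_eq.2 (show j' ≠ 0 by
        rintro rfl
        rw [Fin.val_zero] at hge hn
        omega)
      let α : ScrollCol e := ⟨i, j'⟩
      let β : ScrollCol e := ⟨i₂, j₂⟩
      have hx := exchange_mem e K α β d₀
      have hex := varExp_exchange e α β
      obtain ⟨d₁, hd₁, hr⟩ := ih α.2.castSucc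
        (Finsupp.single (⟨β.1, β.2.succ⟩ : ScrollVar e) 1 + d₀)
        (by simp [α] at hn ⊢; simp at hge; omega)
        (by
          rw [← h, map_add, map_add, paramExp_single, paramExp_single, ← add_assoc, ← add_assoc]
          exact congrArg (· + _) hex)
      refine ⟨d₁, hd₁, ?_⟩
      convert! sub_mem hr hx using 1
      exact (sub_sub_sub_cancel_left _ _ _).symm

/-- Induction on the degree: a variable of d' lies in some block i, so d also contains a variable of
that block, which `exists_rewrite` moves to the required index; then the common variable is
cancelled. -/
theorem binomial_mem (K : Type*) [CommRing K] (n : ℕ) :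
    ∀ d d' : ScrollVar e →₀ ℕ, d'.degree = n → paramExp e d = paramExp e d' →
      monomial d (1 : K) - monomial d' (1 : K) ∈
        minorIdeal (scrollMatrix e (0 : Fin k → ℕ → K)) := by
  induction n with
  | zero =>
    intro d d' hn h
    obtain rfl : d' = 0 := (Finsupp.degree_eq_zero_iff d').1 hn
    have : d = 0 := by
      by_contra hd
      obtain ⟨v, hv⟩ := Finsupp.ne_iff.1 hd
      have h0 := DFunLike.congr_fun h (Sum.inr v.1)
      rw [map_zero, paramExp_apply, Finsupp.zero_apply, Finset.sum_eq_zero_iff] at h0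
      have := h0 v (Finset.mem_univ _)
      simp [varExp_z] at this
      exact hv this
    simp [this]
  | succ n ih =>
    intro d d' hn h
    have hd' : d' ≠ 0 := by rintro rfl; simp at hn
    obtain ⟨⟨i, j⟩, hv⟩ := Finsupp.ne_iff.1 hd'
    obtain ⟨d₀', rfl⟩ : ∃ d₀', d' = Finsupp.single (⟨i, j⟩ : ScrollVar e) 1 + d₀' := by
      refine ⟨d' - Finsupp.single ⟨i, j⟩ 1, ?_⟩
      rw [add_comm, tsub_add_cancel_of_le]
      rw [Finsupp.single_le_iff]
      simp only [Finsupp.coe_zero, Pi.zero_apply] at hv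
      omega
    rw [map_add, paramExp_single] at h
    obtain ⟨⟨i', j'⟩, d₀, rfl, hv'⟩ := exists_mem_of_paramExp_ne_zero e (d := d)
      (x := Sum.inr i) (by rw [h]; simp [varExp_z])
    obtain rfl : i' = i := by simpa [varExp_z] using hv'
    rw [map_add, paramExp_single] at h
    obtain ⟨d₁, hd₁, hr⟩ := exists_rewrite e K i' j d₀' _ j' d₀ rfl h
    have hn' : d₀'.degree = n := by
      rw [map_add, Finsupp.degree_single] at hn
      omega
    have h2 := Ideal.mul_mem_left _ (X (⟨i', j⟩ : ScrollVar e)) (ih d₁ d₀' hn' hd₁)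
    rw [mul_sub] at h2
    simp only [X, monomial_mul, mul_one] at h2
    have := add_mem hr h2
    rwa [sub_add_sub_cancel] at this

/-- The ideal of the scroll is generated by the minors. -/
theorem mem_minorIdeal_of_param_eq_zero {K : Type*} [CommRing K] {f : MvPolynomial (ScrollVar e) K}
    (hf : param K e f = 0) : f ∈ minorIdeal (scrollMatrix e (0 : Fin k → ℕ → K)) := by
  classical
  set J := minorIdeal (scrollMatrix e (0 : Fin k → ℕ → K))
  -- A linear left inverse of the parametrisation modulo the minors: each monomial in the image goes
  -- to the class of a chosen preimage. By `binomial_mem` the choice does not matter; the value 0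
  -- elsewhere is irrelevant.
  let ρ : CoxRing K k →ₗ[K] (MvPolynomial (ScrollVar e) K ⧸ J) :=
    (basisMonomials _ K).constr K fun x =>
      if h : ∃ d, paramExp e d = x then Ideal.Quotient.mk J (monomial h.choose 1) else 0
  have hρ : ρ ∘ₗ (param K e).toLinearMap = (Ideal.Quotient.mkₐ K J).toLinearMap := by
    refine (basisMonomials _ K).ext fun d => ?_
    have hd : ∃ d', paramExp e d' = paramExp e d := ⟨d, rfl⟩
    simp only [coe_basisMonomials, LinearMap.comp_apply, AlgHom.toLinearMap_apply, param_monomial]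
    have := (basisMonomials (Fin 2 ⊕ Fin k) K).constr_basis K (fun x =>
      if h : ∃ d, paramExp e d = x then Ideal.Quotient.mk J (monomial h.choose 1) else 0)
      (paramExp e d)
    rw [coe_basisMonomials] at this
    simp only [ρ]
    rw [this, dif_pos hd]
    exact (Ideal.Quotient.mk_eq_mk_iff_sub_mem _ _).2
      (binomial_mem e K _ _ _ rfl hd.choose_spec)
  have h := LinearMap.congr_fun hρ f
  simp only [LinearMap.comp_apply, AlgHom.toLinearMap_apply, hf, map_zero] at h
  exact Ideal.Quotient.eq_zero_iff_mem.1 h.symm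

/-- Greedy choice: peel off one z^{(i)} together with as many t's as possible and fill up with s's.
The balance of exponents guarantees that enough s's remain. -/
theorem exists_paramExp_eq (n : ℕ) : ∀ x : Fin 2 ⊕ Fin k →₀ ℕ, ∑ i, x (Sum.inr i) = n →
    x (Sum.inl 0) + x (Sum.inl 1) = ∑ i, e i * x (Sum.inr i) →
    ∃ d, paramExp e d = x ∧ d.degree = n := by
  induction n with
  | zero =>
    intro x hn hx
    have h0 : ∀ i, x (Sum.inr i) = 0 := by simpa using hn
    simp [h0] at hx
    refine ⟨0, ?_, by simp⟩
    ext y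
    rcases y with y | y
    · fin_cases y
      · simp [hx.1]
      · simp [hx.2]
    · simp [h0]
  | succ n ih =>
    intro x hn hx
    obtain ⟨i, -, hi⟩ := Finset.exists_ne_zero_of_sum_ne_zero (hn.trans_ne (Nat.succ_ne_zero n))
    have hle : e i * x (Sum.inr i) ≤ x (Sum.inl 0) + x (Sum.inl 1) := by
      rw [hx]
      exact Finset.single_le_sum (f := fun i => e i * x (Sum.inr i)) (fun _ _ => Nat.zero_le _)
        (Finset.mem_univ i)
    have hei : e i ≤ e i * x (Sum.inr i) := Nat.le_mul_of_pos_right _ (Nat.pos_of_ne_zero hi)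
    obtain ⟨j, hj⟩ : ∃ j : Fin (e i + 1), (j : ℕ) = min (e i) (x (Sum.inl 1)) :=
      ⟨⟨min (e i) (x (Sum.inl 1)), by omega⟩, rfl⟩
    let v : ScrollVar e := ⟨i, j⟩
    have hv : varExp e v ≤ x := by
      intro y
      rcases y with y | y
      · fin_cases y
        · simp [varExp_s, v]; omega
        · simp [varExp_t, v]; omega
      · simp only [varExp_z, v]
        split_ifs with h
        · subst h; omega
        · omega
    obtain ⟨x₀, rfl⟩ := exists_add_of_le hv
    have hz : ∑ l, e l * varExp e v (Sum.inr l) = e i := by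
      simp [varExp_z, v]
    have hz' : ∑ l, varExp e v (Sum.inr l) = 1 := by
      simp [varExp_z, v]
    obtain ⟨d, hdx, hd⟩ := ih x₀
      (by
        simp only [Finsupp.add_apply, Finset.sum_add_distrib, hz'] at hn
        omega)
      (by
        simp only [Finsupp.add_apply, Finset.sum_add_distrib, mul_add, hz, varExp_s, varExp_t] at hx
        simp only [v] at hx
        have := j.2
        omega)
    refine ⟨Finsupp.single v 1 + d, ?_, ?_⟩
    · rw [map_add, paramExp_single, hdx]
    · rw [map_add, Finsupp.degree_single, hd, add_comm]

end Toric

/-! ### Weighted homogeneity and divisibility. -/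

section Grading

theorem isWeightedHomogeneous_of_pow_X_mul {R σ G : Type*} [CommRing R] [AddCancelCommMonoid G]
    (w : σ → G) {i : σ} {M : ℕ} {y : MvPolynomial σ R} {n : G}
    (h : IsWeightedHomogeneous w (X i ^ M * y) (M • w i + n)) : IsWeightedHomogeneous w y n := by
  intro d hd
  rw [X_pow_eq_monomial] at h
  have := h (d := Finsupp.single i M + d) (by rwa [coeff_monomial_mul, one_mul])
  rw [map_add, Finsupp.weight_single] at this
  exact add_left_cancel this

/-- Only the component of Q of weight n can contribute to the product in weight n + m. -/
theorem exists_isWeightedHomogeneous_mul_eq {R σ G : Type*} [CommRing R] [AddCancelCommMonoid G]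
    (w : σ → G) {Q P : MvPolynomial σ R} {n m : G} (hP : IsWeightedHomogeneous w P m)
    (hQP : IsWeightedHomogeneous w (Q * P) (n + m)) :
    ∃ Q', IsWeightedHomogeneous w Q' n ∧ Q' * P = Q * P := by
  classical
  refine ⟨weightedHomogeneousComponent w n Q,
    weightedHomogeneousComponent_isWeightedHomogeneous n Q, ?_⟩
  have h1 := (weightedHomogeneousComponent_isWeightedHomogeneous (w := w) n Q).mul hP
  ext d
  by_cases hd : Finsupp.weight w d = n + m
  · rw [coeff_mul, coeff_mul]
    refine Finset.sum_congr rfl fun x hx => ?_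
    by_cases hx2 : coeff x.2 P = 0
    · rw [hx2, mul_zero, mul_zero]
    · have h2 := hP hx2
      rw [← Finset.HasAntidiagonal.mem_antidiagonal.1 hx, map_add, h2] at hd
      rw [coeff_weightedHomogeneousComponent, if_pos (add_right_cancel hd)]
  · rw [h1.coeff_eq_zero _ hd, hQP.coeff_eq_zero _ hd]

/-- With non-negative weights every term of a multiple of P has weight at least m. This is applied
to the degree in the z^{(i)}, where P has degree a and the multiple has degree a − 1. -/
theorem mul_eq_zero_of_isWeightedHomogeneous_lt {R σ : Type*} [CommRing R]
    (w : σ → ℤ) (hw : ∀ d : σ →₀ ℕ, 0 ≤ Finsupp.weight w d)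
    {Q P : MvPolynomial σ R} {n m : ℤ} (hP : IsWeightedHomogeneous w P m)
    (hQP : IsWeightedHomogeneous w (Q * P) n) (hnm : n < m) : Q * P = 0 := by
  classical
  ext d
  by_cases hd : Finsupp.weight w d = n
  · rw [coeff_mul, coeff_zero]
    refine Finset.sum_eq_zero fun x hx => ?_
    by_contra hne
    have h2 := hP (right_ne_zero_of_mul hne)
    rw [← Finset.HasAntidiagonal.mem_antidiagonal.1 hx, map_add, h2] at hd
    have := hw x.1
    omega
  · rw [hQP.coeff_eq_zero _ hd, coeff_zero]

theorem isWeightedHomogeneous_divMonomial {R σ G : Type*} [CommRing R] [AddCancelCommMonoid G]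
    (w : σ → G) {F : MvPolynomial σ R} {i : σ} {M : ℕ} {n : G}
    (h : IsWeightedHomogeneous w F (M • w i + n)) :
    IsWeightedHomogeneous w (F.divMonomial (Finsupp.single i M)) n := by
  intro d hd
  rw [coeff_divMonomial] at hd
  have := h hd
  rw [map_add, Finsupp.weight_single] at this
  exact add_left_cancel this

theorem isWeightedHomogeneous_modMonomial {R σ G : Type*} [CommRing R] [AddCommMonoid G]
    (w : σ → G) {F : MvPolynomial σ R} {a : σ →₀ ℕ} {n : G}
    (h : IsWeightedHomogeneous w F n) :
    IsWeightedHomogeneous w (F.modMonomial a) n := by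
  intro d hd
  by_cases had : a ≤ d
  · exact absurd (coeff_modMonomial_of_le _ had) hd
  · rw [coeff_modMonomial_of_not_le _ had] at hd
    exact h hd

/-- A polynomial all of whose monomials are divisible by `x^M` or `y^M` lies in the ideal
`(x^M, y^M)`, homogeneously for any weights. -/
theorem exists_eq_pow_mul_sub_pow_mul {R σ : Type*} [CommRing R] {x y : σ} {M : ℕ}
    {F : MvPolynomial σ R}
    (hF : ∀ d, coeff d F ≠ 0 → M ≤ d x ∨ M ≤ d y) :
    ∃ h h' : MvPolynomial σ R, F = X x ^ M * h' - X y ^ M * h ∧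
      ∀ (w : σ → ℤ) (n : ℤ), IsWeightedHomogeneous w F n → w x = w y →
        IsWeightedHomogeneous w h (n - M * w x) ∧ IsWeightedHomogeneous w h' (n - M * w x) := by
  -- Division by x^M leaves a remainder all of whose monomials are divisible by y^M.
  set G := F.modMonomial (Finsupp.single x M) with hG
  have hGy : monomial (Finsupp.single y M) (1 : R) ∣ G := by
    rw [monomial_one_dvd_iff_modMonomial_eq_zero]
    ext d
    rw [coeff_zero]
    by_cases hd : Finsupp.single y M ≤ d
    · exact coeff_modMonomial_of_le _ hd
    rw [coeff_modMonomial_of_not_le _ hd]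
    by_cases hd' : Finsupp.single x M ≤ d
    · exact coeff_modMonomial_of_le _ hd'
    rw [coeff_modMonomial_of_not_le _ hd']
    by_contra hne
    rw [Finsupp.single_le_iff] at hd hd'
    rcases hF d hne with h | h <;> contradiction
  have hG0 := monomial_one_dvd_iff_modMonomial_eq_zero.1 hGy
  refine ⟨-(G.divMonomial (Finsupp.single y M)), F.divMonomial (Finsupp.single x M), ?_, ?_⟩
  · have h1 := divMonomial_add_modMonomial F (Finsupp.single x M)
    have h2 := divMonomial_add_modMonomial G (Finsupp.single y M)
    rw [hG0, add_zero] at h2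
    rw [← hG] at h1
    rw [X_pow_eq_monomial, X_pow_eq_monomial, mul_neg, sub_neg_eq_add, h2, h1]
  · intro w n hw hxy
    constructor
    · refine IsWeightedHomogeneous.neg ?_
      refine isWeightedHomogeneous_divMonomial w ?_
      rw [nsmul_eq_mul, ← hxy, add_sub_cancel]
      exact isWeightedHomogeneous_modMonomial w hw
    · refine isWeightedHomogeneous_divMonomial w ?_
      rw [nsmul_eq_mul, add_sub_cancel]
      exact hw

end Grading

/-! ### The bigrading of the Cox ring and the image of the parametrisation. -/

section ScrollGrading

variable {k : ℕ} (e : Fin k → ℕ)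

/-- The weights for which the coordinates of the scroll have weight zero: `s`, `t` have
weight `1` and `z^{(i)}` has weight `-e_i`. -/
def wt : Fin 2 ⊕ Fin k → ℤ := Sum.elim (fun _ => 1) fun i => -(e i : ℤ)

/-- The weights counting the degree in the `z^{(i)}`. -/
def zwt (k : ℕ) : Fin 2 ⊕ Fin k → ℤ := Sum.elim (fun _ => 0) fun _ => 1

theorem weight_wt (x : Fin 2 ⊕ Fin k →₀ ℕ) :
    Finsupp.weight (wt e) x =
      (x (Sum.inl 0) : ℤ) + x (Sum.inl 1) - ∑ i, (e i : ℤ) * x (Sum.inr i) := by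
  rw [Finsupp.weight_apply, Finsupp.sum_fintype _ _ (by simp), Fintype.sum_sum_type,
    Fin.sum_univ_two]
  simp [wt, sub_eq_add_neg, mul_comm]

theorem weight_zwt (x : Fin 2 ⊕ Fin k →₀ ℕ) :
    Finsupp.weight (zwt k) x = ∑ i, (x (Sum.inr i) : ℤ) := by
  rw [Finsupp.weight_apply, Finsupp.sum_fintype _ _ (by simp), Fintype.sum_sum_type,
    Fin.sum_univ_two]
  simp [zwt]

theorem weight_wt_varExp (v : ScrollVar e) : Finsupp.weight (wt e) (varExp e v) = 0 := by
  rw [weight_wt, varExp_s, varExp_t]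
  have := v.2.2
  simp [varExp_z]
  omega

theorem weight_zwt_varExp (v : ScrollVar e) : Finsupp.weight (zwt k) (varExp e v) = 1 := by
  simp [weight_zwt, varExp_z]

theorem weight_paramExp (w : Fin 2 ⊕ Fin k → ℤ) (c : ℤ)
    (hw : ∀ v, Finsupp.weight w (varExp e v) = c) (d : ScrollVar e →₀ ℕ) :
    Finsupp.weight w (paramExp e d) = d.degree * c := by
  rw [paramExp, Finsupp.linearCombination_apply, Finsupp.sum, map_sum]
  simp only [map_nsmul, hw]
  rw [Finsupp.degree_apply, Nat.cast_sum, Finset.sum_mul]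
  simp

variable {K : Type*} [CommRing K]

theorem param_eq_sum (f : MvPolynomial (ScrollVar e) K) :
    param K e f = ∑ d ∈ f.support, monomial (paramExp e d) (coeff d f) := by
  conv_lhs => rw [f.as_sum]
  rw [map_sum]
  simp only [param_monomial]

theorem isWeightedHomogeneous_wt_param (f : MvPolynomial (ScrollVar e) K) :
    IsWeightedHomogeneous (wt e) (param K e f) 0 := by
  rw [param_eq_sum]
  refine IsWeightedHomogeneous.sum _ _ _ fun d _ => isWeightedHomogeneous_monomial _ _ _ ?_
  rw [weight_paramExp e _ 0 (weight_wt_varExp e), mul_zero]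

theorem isWeightedHomogeneous_zwt_param {f : MvPolynomial (ScrollVar e) K} {n : ℕ}
    (hf : f.IsHomogeneous n) : IsWeightedHomogeneous (zwt k) (param K e f) n := by
  rw [param_eq_sum]
  refine IsWeightedHomogeneous.sum _ _ _ fun d hd => isWeightedHomogeneous_monomial _ _ _ ?_
  rw [weight_paramExp e _ 1 (weight_zwt_varExp e), mul_one]
  have := hf (mem_support_iff.1 hd)
  rw [← this, Finsupp.degree_eq_weight_one]
  rfl

/-- The image of the parametrisation consists of the polynomials of weight zero. -/
theorem exists_param_eq {y : CoxRing K k} {n : ℕ} (hy : IsWeightedHomogeneous (wt e) y 0)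
    (hy' : IsWeightedHomogeneous (zwt k) y n) :
    ∃ f : MvPolynomial (ScrollVar e) K, f.IsHomogeneous n ∧ param K e f = y := by
  have h : ∀ x, ∃ f : MvPolynomial (ScrollVar e) K, f.IsHomogeneous n ∧
      param K e f = monomial x (coeff x y) := by
    intro x
    by_cases hx : coeff x y = 0
    · exact ⟨0, isHomogeneous_zero _ _ _, by simp [hx]⟩
    have h1 := hy hx
    have h2 := hy' hx
    rw [weight_wt] at h1
    rw [weight_zwt] at h2
    obtain ⟨d, rfl, hd⟩ := exists_paramExp_eq e n x (by exact_mod_cast h2)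
      (by have := sub_eq_zero.1 h1; exact_mod_cast this)
    exact ⟨monomial d _, isHomogeneous_monomial _ hd, param_monomial e d _⟩
  choose f hf hfx using h
  refine ⟨∑ x ∈ y.support, f x, IsHomogeneous.sum _ _ _ fun x _ => hf x, ?_⟩
  rw [map_sum, Finset.sum_congr rfl fun x _ => hfx x]
  exact y.as_sum.symm

/-- Each monomial of weight b splits as s^{b−m} t^m times a monomial of weight zero, with m the
smaller of b and its t-exponent. Hence the multiples of P of weight zero are generated by the images
of the P_m. -/
theorem exists_eq_sum_pow_mul_param {b : ℕ} {Q : CoxRing K k}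
    (hQ : IsWeightedHomogeneous (wt e) Q b) :
    ∃ q : Fin (b + 1) → MvPolynomial (ScrollVar e) K,
      Q = ∑ m : Fin (b + 1), sVar K k ^ (b - (m : ℕ)) * tVar K k ^ (m : ℕ) * param K e (q m) := by
  classical
  have h : ∀ x, ∃ q : Fin (b + 1) → MvPolynomial (ScrollVar e) K,
      monomial x (coeff x Q) =
        ∑ m : Fin (b + 1), sVar K k ^ (b - (m : ℕ)) * tVar K k ^ (m : ℕ) * param K e (q m) := by
    intro x
    by_cases hx : coeff x Q = 0
    · exact ⟨0, by simp [hx]⟩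
    have h1 := hQ hx
    rw [weight_wt] at h1
    have h1' : x (Sum.inl 0) + x (Sum.inl 1) = ∑ i, e i * x (Sum.inr i) + b := by
      have := sub_eq_iff_eq_add'.1 h1
      exact_mod_cast this
    obtain ⟨m, hm⟩ : ∃ m : Fin (b + 1), (m : ℕ) = min b (x (Sum.inl 1)) :=
      ⟨⟨min b (x (Sum.inl 1)), by omega⟩, rfl⟩
    have hle : Finsupp.single (Sum.inl 0) (b - (m : ℕ)) + Finsupp.single (Sum.inl 1) (m : ℕ) ≤ x := by
      intro y
      rcases y with y | y
      · fin_cases y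
        · simp; omega
        · simp; omega
      · simp
    obtain ⟨x₀, rfl⟩ := exists_add_of_le hle
    obtain ⟨d, rfl, -⟩ := exists_paramExp_eq e _ x₀ rfl
      (by
        simp at h1'
        have := m.2
        omega)
    generalize coeff _ Q = c
    refine ⟨Pi.single m (monomial d c), ?_⟩
    rw [Finset.sum_eq_single m]
    · rw [Pi.single_eq_same, param_monomial, sVar, tVar, X_pow_eq_monomial, X_pow_eq_monomial,
        monomial_mul, monomial_mul]
      simp
    · intro m' _ hm'
      simp [Pi.single_eq_of_ne hm']
    · simp
  choose q hq using h
  refine ⟨fun m => ∑ x ∈ Q.support, q x m, ?_⟩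
  conv_lhs => rw [Q.as_sum, Finset.sum_congr rfl fun x _ => hq x]
  rw [Finset.sum_comm]
  simp only [map_sum, Finset.mul_sum]

end ScrollGrading

/-! ### Rolling factors on the undeformed scroll. -/

section Roll

variable {k : ℕ} (e : Fin k → ℕ) {K : Type*} [CommRing K]

/-- Setting s = 0, t = 1 and z^{(i)} = z^{(i)}_{e_i} in the Cox ring inverts the parametrisation
modulo the entries of the top row, and kills multiples of s. -/
theorem mem_topRow_of_dvd {f : MvPolynomial (ScrollVar e) K} (hf : sVar K k ∣ param K e f) :
    ∃ q : ScrollCol e → MvPolynomial (ScrollVar e) K,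
      f = ∑ α, q α * scrollMatrix e (0 : Fin k → ℕ → K) 0 α := by
  set T := Ideal.span (Set.range (scrollMatrix e (0 : Fin k → ℕ → K) 0)) with hT
  suffices f ∈ T by
    obtain ⟨q, hq⟩ := (Ideal.mem_span_range_iff_exists_fun).1 this
    exact ⟨q, hq.symm⟩
  let κ : CoxRing K k →ₐ[K] (MvPolynomial (ScrollVar e) K ⧸ T) :=
    aeval (Sum.elim ![0, 1] fun i => Ideal.Quotient.mk T (X ⟨i, Fin.last _⟩))
  have h : κ.comp (param K e) = Ideal.Quotient.mkₐ K T := by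
    refine MvPolynomial.algHom_ext fun v => ?_
    obtain ⟨i, j⟩ := v
    rw [AlgHom.comp_apply, param_X]
    rcases Fin.eq_castSucc_or_eq_last j with ⟨j, rfl⟩ | rfl
    · have h0 : Ideal.Quotient.mk T (X ⟨i, j.castSucc⟩) = 0 := by
        refine Ideal.Quotient.eq_zero_iff_mem.2 (Ideal.subset_span ⟨⟨i, j⟩, ?_⟩)
        simp [scrollMatrix]
      have := j.2
      simp [κ, zVar, sVar, tVar, h0, show e i - (j : ℕ) ≠ 0 by omega]
    · simp [κ, zVar, sVar, tVar]
  have h2 := DFunLike.congr_fun h f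
  obtain ⟨y, hy⟩ := hf
  rw [AlgHom.comp_apply, hy, map_mul] at h2
  have h0 : κ (sVar K k) = 0 := by simp [κ, sVar]
  rw [h0, zero_mul] at h2
  exact Ideal.Quotient.eq_zero_iff_mem.1 h2.symm

/-- For the minor of columns α, β take the Koszul relation of the top entries, x_α at β and −x_β at
α: it vanishes on the top row and gives the minor on the bottom row. So elements of the minor ideal
can be absorbed into the bottom equation alone. -/
theorem exists_bottomRow_of_mem_minorIdeal {S C : Type*} [CommRing S] [Fintype C]
    (M : Matrix (Fin 2) C S) {h : S} (hh : h ∈ minorIdeal M) :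
    ∃ q : C → S, ∑ α, q α * M 0 α = 0 ∧ ∑ α, q α * M 1 α = h := by
  classical
  induction hh using Submodule.span_induction with
  | mem x hx =>
    obtain ⟨α, β, rfl⟩ := hx
    refine ⟨Pi.single β (M 0 α) - Pi.single α (M 0 β), ?_, ?_⟩
    · simp [sub_mul, Finset.sum_sub_distrib, Pi.single_apply, mul_comm (M 0 α)]
    · simp [sub_mul, Finset.sum_sub_distrib, Pi.single_apply, mul_comm (M 0 β)]
  | zero => exact ⟨0, by simp⟩
  | add x y _ _ hx hy =>
    obtain ⟨q, h1, h2⟩ := hx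
    obtain ⟨r, h3, h4⟩ := hy
    exact ⟨q + r, by simp [add_mul, Finset.sum_add_distrib, h1, h3],
      by simp [add_mul, Finset.sum_add_distrib, h2, h4]⟩
  | smul a x _ hx =>
    obtain ⟨q, h1, h2⟩ := hx
    exact ⟨a • q, by simp [mul_assoc, ← Finset.mul_sum, h1],
      by simp [mul_assoc, ← Finset.mul_sum, h2]⟩

theorem param_rows (α : ScrollCol e) :
    sVar K k * param K e (scrollMatrix e (0 : Fin k → ℕ → K) 1 α) =
      tVar K k * param K e (scrollMatrix e (0 : Fin k → ℕ → K) 0 α) := by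
  have := α.2.2
  simp only [scrollMatrix, Matrix.of_apply, Matrix.cons_val_one, Matrix.cons_val_zero,
    Pi.zero_apply, C_0, add_zero, param_X, Fin.val_succ, Fin.val_castSucc]
  rw [show e α.1 - (α.2 : ℕ) = e α.1 - (α.2 + 1) + 1 by omega]
  ring

theorem not_sVar_dvd_tVar [Nontrivial K] : ¬ sVar K k ∣ tVar K k := by
  simp [sVar, tVar, X_dvd_X]

/-- Two forms on the scroll with quotient `t / s` are in rolling factors format. -/
theorem exists_rolling [IsDomain K] {f g : MvPolynomial (ScrollVar e) K}
    (h : sVar K k * param K e g = tVar K k * param K e f) :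
    ∃ q : ScrollCol e → MvPolynomial (ScrollVar e) K,
      f = ∑ α, q α * scrollMatrix e (0 : Fin k → ℕ → K) 0 α ∧
      g = ∑ α, q α * scrollMatrix e (0 : Fin k → ℕ → K) 1 α := by
  have hs : sVar K k ∣ param K e f :=
    ((X_prime (i := Sum.inl 0)).dvd_or_dvd ⟨_, h.symm⟩).resolve_left not_sVar_dvd_tVar
  obtain ⟨q, hq⟩ := mem_topRow_of_dvd e hs
  have hker : param K e (g - ∑ α, q α * scrollMatrix e (0 : Fin k → ℕ → K) 1 α) = 0 := by
    refine (mul_eq_zero.1 ?_).resolve_left (X_ne_zero (R := K) (Sum.inl 0 : Fin 2 ⊕ Fin k))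
    change sVar K k * _ = 0
    rw [map_sub, mul_sub, h, map_sum, Finset.mul_sum, hq, map_sum, Finset.mul_sum,
      ← Finset.sum_sub_distrib]
    refine Finset.sum_eq_zero fun α _ => ?_
    rw [map_mul, map_mul]
    linear_combination -(param K e (q α)) * param_rows (K := K) e α
  obtain ⟨r, hr0, hr1⟩ := exists_bottomRow_of_mem_minorIdeal _
    (mem_minorIdeal_of_param_eq_zero e hker)
  refine ⟨q + r, ?_, ?_⟩
  · simp only [Pi.add_apply, add_mul, Finset.sum_add_distrib, hr0, ← hq, add_zero]
  · simp only [Pi.add_apply, add_mul, Finset.sum_add_distrib, hr1]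
    ring

end Roll

/-! ### Rescaling of ε. -/

section DualMap

/-- The ring homomorphism `x + ε y ↦ x + ε y u`. -/
def dualMap (K : Type*) {R : Type*} [CommRing K] [CommRing R] [Algebra K R] (u : R) :
    DualNumber K →+* DualNumber R where
  toFun x := TrivSqZeroExt.inl (algebraMap K R x.fst) + TrivSqZeroExt.inr (algebraMap K R x.snd * u)
  map_one' := by ext <;> simp
  map_zero' := by ext <;> simp
  map_add' x y := by ext <;> simp [add_mul]
  map_mul' x y := by ext <;> simp; ring

theorem dualNumber_ext {R : Type*} {x y : DualNumber R} (h1 : x.fst = y.fst) (h2 : x.snd = y.snd) :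
    x = y :=
  TrivSqZeroExt.ext h1 h2

end DualMap

/-! ### Extending the parametrisation to the deformed scroll in a chart. -/

section Chart

variable {k : ℕ} (e : Fin k → ℕ) {K : Type*} [CommRing K]

/-- A first-order deformation of the parametrisation in a chart of the scroll, with denominators
cleared by sending `ε` to `u ε`. -/
noncomputable def chart (u : CoxRing K k) (d : ScrollVar e → CoxRing K k) :
    MvPolynomial (ScrollVar e) (DualNumber K) →+* DualNumber (CoxRing K k) :=
  eval₂Hom (dualMap K u) fun v => TrivSqZeroExt.inl (param K e (X v)) + TrivSqZeroExt.inr (d v)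

/-- The derivation along the parametrisation with given values on the coordinates. -/
noncomputable def derivAlong (d : ScrollVar e → CoxRing K k) (F : MvPolynomial (ScrollVar e) K) :
    CoxRing K k :=
  ∑ v, param K e (pderiv v F) * d v

variable {e}

theorem derivAlong_add (d : ScrollVar e → CoxRing K k) (F G : MvPolynomial (ScrollVar e) K) :
    derivAlong e d (F + G) = derivAlong e d F + derivAlong e d G := by
  simp [derivAlong, add_mul, Finset.sum_add_distrib]

theorem derivAlong_C (d : ScrollVar e → CoxRing K k) (c : K) :
    derivAlong e d (C c) = 0 := by
  simp [derivAlong]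

theorem derivAlong_mul_X (d : ScrollVar e → CoxRing K k) (F : MvPolynomial (ScrollVar e) K)
    (v : ScrollVar e) :
    derivAlong e d (F * X v) = derivAlong e d F * param K e (X v) + param K e F * d v := by
  classical
  simp only [derivAlong, pderiv_mul, pderiv_X, map_add, map_mul, add_mul, Finset.sum_add_distrib,
    Finset.sum_mul]
  congr 1
  · exact Finset.sum_congr rfl fun _ _ => by ring
  · rw [Finset.sum_eq_single v]
    · simp
    · intro w _ hw
      simp [hw.symm]
    · simp

theorem chart_map (u : CoxRing K k) (d : ScrollVar e → CoxRing K k)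
    (F : MvPolynomial (ScrollVar e) K) :
    chart e u d (MvPolynomial.map (algebraMap K (DualNumber K)) F) =
      TrivSqZeroExt.inl (param K e F) + TrivSqZeroExt.inr (derivAlong e d F) := by
  induction F using MvPolynomial.induction_on with
  | C c =>
    rw [derivAlong_C, map_C]
    apply dualNumber_ext <;> simp [chart, dualMap, TrivSqZeroExt.algebraMap_eq_inl, param]
  | add F G hF hG =>
    rw [map_add, map_add, hF, hG, derivAlong_add, map_add]
    apply dualNumber_ext <;> simp
  | mul_X F v hF =>
    rw [map_mul, map_mul, hF, derivAlong_mul_X, map_X]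
    have hX : chart e u d (X v) = TrivSqZeroExt.inl (param K e (X v)) + TrivSqZeroExt.inr (d v) := by
      simp [chart]
    rw [hX, map_mul]
    apply dualNumber_ext
    · simp
    · simp; ring

theorem chart_perturb (u : CoxRing K k) (d : ScrollVar e → CoxRing K k)
    (F F' : MvPolynomial (ScrollVar e) K) :
    chart e u d (perturb F F') =
      TrivSqZeroExt.inl (param K e F) +
        TrivSqZeroExt.inr (derivAlong e d F + u * param K e F') := by
  have hC : chart e u d (C DualNumber.eps) = TrivSqZeroExt.inr u := by
    simp [chart, dualMap]
  rw [perturb, map_add, map_mul, chart_map, chart_map, hC]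
  apply dualNumber_ext <;> simp

theorem fst_chart_perturb (u : CoxRing K k) (d : ScrollVar e → CoxRing K k)
    (F F' : MvPolynomial (ScrollVar e) K) :
    (chart e u d (perturb F F')).fst = param K e F := by
  simp [chart_perturb]

theorem snd_chart_perturb (u : CoxRing K k) (d : ScrollVar e → CoxRing K k)
    (F F' : MvPolynomial (ScrollVar e) K) :
    (chart e u d (perturb F F')).snd = derivAlong e d F + u * param K e F' := by
  simp [chart_perturb]

/-- The vertical derivation `∑ g_l ∂ / ∂ z^{(l)}`. -/
noncomputable def fibreDeriv (g : Fin k → CoxRing K k) : Derivation K (CoxRing K k) (CoxRing K k) :=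
  ∑ l, g l • pderiv (Sum.inr l)

theorem fibreDeriv_apply (g : Fin k → CoxRing K k) (F : CoxRing K k) :
    fibreDeriv g F = ∑ l, g l * pderiv (Sum.inr l) F := by
  rw [fibreDeriv, ← Derivation.coeFnAddMonoidHom_apply, map_sum, Finset.sum_apply]
  rfl

theorem fibreDeriv_sVar (g : Fin k → CoxRing K k) : fibreDeriv g (sVar K k) = 0 := by
  classical
  simp [fibreDeriv_apply, sVar, pderiv_X]

theorem fibreDeriv_tVar (g : Fin k → CoxRing K k) : fibreDeriv g (tVar K k) = 0 := by
  classical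
  simp [fibreDeriv_apply, tVar, pderiv_X]

theorem fibreDeriv_zVar (g : Fin k → CoxRing K k) (i : Fin k) :
    fibreDeriv g (zVar K i) = g i := by
  classical
  simp [fibreDeriv_apply, zVar, pderiv_X, Pi.single_apply, Sum.inr.injEq]

theorem fibreDeriv_pow_mul (g : Fin k → CoxRing K k) (m n : ℕ) (F : CoxRing K k) :
    fibreDeriv g (sVar K k ^ m * tVar K k ^ n * F) =
      sVar K k ^ m * tVar K k ^ n * fibreDeriv g F := by
  simp [Derivation.leibniz, Derivation.leibniz_pow, fibreDeriv_sVar, fibreDeriv_tVar]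

/-- The chain rule for a derivation and the parametrisation. -/
theorem derivation_param (E : Derivation K (CoxRing K k) (CoxRing K k))
    (F : MvPolynomial (ScrollVar e) K) :
    E (param K e F) = derivAlong e (fun v => E (param K e (X v))) F := by
  induction F using MvPolynomial.induction_on with
  | C c =>
    rw [derivAlong_C]
    have : param K e (C c) = algebraMap K _ c := (param K e).commutes c
    rw [this, E.map_algebraMap]
  | add F G hF hG => rw [map_add, map_add, hF, hG, derivAlong_add]
  | mul_X F v hF =>
    rw [derivAlong_mul_X, map_mul, Derivation.leibniz, hF]
    simp only [smul_eq_mul]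
    ring

/-- The values `d` of the deformed coordinates are such that the bottom row of the deformed matrix
is `t / s` times its top row. -/
def IsChart (e : Fin k → ℕ) (ζ : Fin k → ℕ → K) (u : CoxRing K k)
    (d : ScrollVar e → CoxRing K k) : Prop :=
  ∀ α : ScrollCol e, sVar K k * (d ⟨α.1, α.2.succ⟩ + u * C (ζ α.1 ((α.2 : ℕ) + 1))) =
    tVar K k * d ⟨α.1, α.2.castSucc⟩

theorem deformedMatrix_zero (ζ : Fin k → ℕ → K) (α : ScrollCol e) :
    deformedMatrix e ζ 0 α = perturb (scrollMatrix e (0 : Fin k → ℕ → K) 0 α) 0 := by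
  simp [deformedMatrix, scrollMatrix, perturb]

theorem deformedMatrix_one (ζ : Fin k → ℕ → K) (α : ScrollCol e) :
    deformedMatrix e ζ 1 α =
      perturb (scrollMatrix e (0 : Fin k → ℕ → K) 1 α) (C (ζ α.1 ((α.2 : ℕ) + 1))) := by
  have h : (C (ζ α.1 ((α.2 : ℕ) + 1) • DualNumber.eps) :
      MvPolynomial (ScrollVar e) (DualNumber K)) =
      C DualNumber.eps * C (algebraMap K (DualNumber K) (ζ α.1 ((α.2 : ℕ) + 1))) := by
    rw [← C_mul, Algebra.smul_def, mul_comm]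
  simp only [deformedMatrix, scrollMatrix, perturb]
  simpa using h

theorem derivAlong_X (d : ScrollVar e → CoxRing K k) (v : ScrollVar e) :
    derivAlong e d (X v) = d v := by
  have := derivAlong_mul_X d 1 v
  rw [one_mul] at this
  rw [this, ← C_1, derivAlong_C]
  simp

theorem chart_rows {ζ : Fin k → ℕ → K} {u : CoxRing K k} {d : ScrollVar e → CoxRing K k}
    (h : IsChart e ζ u d) (α : ScrollCol e) :
    TrivSqZeroExt.inl (sVar K k) * chart e u d (deformedMatrix e ζ 1 α) =
      TrivSqZeroExt.inl (tVar K k) * chart e u d (deformedMatrix e ζ 0 α) := by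
  rw [deformedMatrix_zero, deformedMatrix_one]
  apply dualNumber_ext
  · simp only [DualNumber, TrivSqZeroExt.fst_mul, TrivSqZeroExt.fst_inl, fst_chart_perturb]
    exact param_rows e α
  · have h1 : param K e (C (ζ α.1 ((α.2 : ℕ) + 1))) = C (ζ α.1 ((α.2 : ℕ) + 1)) :=
      (param K e).commutes _
    have h2 := h α
    simp only [chart_perturb, scrollMatrix, Matrix.of_apply, Matrix.cons_val_one,
      Matrix.cons_val_zero, Pi.zero_apply, add_zero, derivAlong_X, h1, map_zero, mul_zero]
    simpa using h2

theorem inl_mul_eq_zero [IsDomain K] {r : CoxRing K k} (hr : r ≠ 0) {x : DualNumber (CoxRing K k)}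
    (h : TrivSqZeroExt.inl r * x = 0) : x = 0 := by
  have h1 := congrArg TrivSqZeroExt.fst h
  have h2 := congrArg TrivSqZeroExt.snd h
  simp [hr] at h1 h2
  exact dualNumber_ext h1 h2

theorem sVar_ne_zero [Nontrivial K] : sVar K k ≠ 0 := X_ne_zero _

theorem tVar_ne_zero [Nontrivial K] : tVar K k ≠ 0 := X_ne_zero _

/-- In a chart the bottom row is t/s times the top row, so s times every minor vanishes, and s is a
non-zero-divisor. -/
theorem chart_eq_zero_of_mem_minorIdeal [IsDomain K] {ζ : Fin k → ℕ → K} {u : CoxRing K k}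
    {d : ScrollVar e → CoxRing K k} (h : IsChart e ζ u d)
    {F : MvPolynomial (ScrollVar e) (DualNumber K)}
    (hF : F ∈ minorIdeal (deformedMatrix e ζ)) : chart e u d F = 0 := by
  rw [← RingHom.mem_ker]
  refine (Ideal.span_le.2 ?_) hF
  rintro _ ⟨α, β, rfl⟩
  rw [SetLike.mem_coe, RingHom.mem_ker]
  refine inl_mul_eq_zero (sVar_ne_zero (K := K)) ?_
  rw [map_sub, map_mul, map_mul]
  linear_combination (chart e u d (deformedMatrix e ζ 0 α)) * chart_rows h β -
    (chart e u d (deformedMatrix e ζ 0 β)) * chart_rows h α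

theorem isWeightedHomogeneous_wt_derivAlong {d : ScrollVar e → CoxRing K k} {n : ℤ}
    (hd : ∀ v, IsWeightedHomogeneous (wt e) (d v) n) (F : MvPolynomial (ScrollVar e) K) :
    IsWeightedHomogeneous (wt e) (derivAlong e d F) n := by
  refine IsWeightedHomogeneous.sum _ _ _ fun v _ => ?_
  have := (isWeightedHomogeneous_wt_param e (pderiv v F)).mul (hd v)
  rwa [zero_add] at this

theorem isWeightedHomogeneous_zwt_derivAlong {d : ScrollVar e → CoxRing K k}
    (hd : ∀ v, IsWeightedHomogeneous (zwt k) (d v) 0) {F : MvPolynomial (ScrollVar e) K} {n : ℕ}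
    (hF : F.IsHomogeneous n) :
    IsWeightedHomogeneous (zwt k) (derivAlong e d F) ((n - 1 : ℕ) : ℤ) := by
  refine IsWeightedHomogeneous.sum _ _ _ fun v _ => ?_
  have := (isWeightedHomogeneous_zwt_param e (hF.pderiv (i := v))).mul (hd v)
  rwa [add_zero] at this

end Chart

/-! ### The two charts and the vector field gluing them. -/

section Charts

variable {k : ℕ} (e : Fin k → ℕ) {K : Type*} [CommRing K] (M : ℕ) (ζ : Fin k → ℕ → K)

/-- The deformation of the coordinates in the chart `s ≠ 0`, multiplied by `s^M`. -/
noncomputable def chartS (v : ScrollVar e) : CoxRing K k :=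
  ∑ c ∈ Finset.range (e v.1 + 1), if c ≤ (v.2 : ℕ) then
    -(C (ζ v.1 c) * sVar K k ^ (M + c - v.2) * tVar K k ^ ((v.2 : ℕ) - c)) else 0

/-- The deformation of the coordinates in the chart `t ≠ 0`, multiplied by `t^M`. -/
noncomputable def chartT (v : ScrollVar e) : CoxRing K k :=
  ∑ c ∈ Finset.range (e v.1 + 1), if c ≤ (v.2 : ℕ) then 0 else
    C (ζ v.1 c) * sVar K k ^ (c - (v.2 : ℕ)) * tVar K k ^ (M + v.2 - c)

/-- The coefficients of the vertical vector field comparing the two charts. -/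
noncomputable def glueCoeff (l : Fin k) : CoxRing K k :=
  ∑ c ∈ Finset.range (e l + 1), C (ζ l c) * sVar K k ^ (M + c - e l) * tVar K k ^ (M - c)

variable {e M}

/-- The recursion z_{j+1} + εζ_{j+1} = (t/s) z_j gives z_j the increment −ε ∑_{c ≤ j} ζ_c
(t/s)^{j−c}. All sums run over the full range of c so that they can be compared term by term. -/
theorem isChart_chartS (hM : ∀ i, e i ≤ M) : IsChart e ζ (sVar K k ^ M) (chartS e M ζ) := by
  rintro ⟨i, j⟩
  have hj := j.2
  have hi := hM i
  have h : sVar K k ^ M * C (ζ i ((j : ℕ) + 1)) = ∑ c ∈ Finset.range (e i + 1),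
      if c = (j : ℕ) + 1 then sVar K k ^ M * C (ζ i c) else 0 := by
    rw [Finset.sum_ite_eq' , if_pos (Finset.mem_range.2 (by omega))]
  simp only [chartS, h]
  rw [← Finset.sum_add_distrib, Finset.mul_sum, Finset.mul_sum]
  refine Finset.sum_congr rfl fun c hc => ?_
  have hc := Finset.mem_range.1 hc
  simp only [Fin.val_succ, Fin.val_castSucc]
  rcases lt_trichotomy c ((j : ℕ) + 1) with h1 | rfl | h1
  · rw [if_pos h1.le, if_neg h1.ne, if_pos (by omega),
      show M + c - (j : ℕ) = M + c - (j + 1) + 1 by omega,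
      show (j : ℕ) + 1 - c = j - c + 1 by omega]
    ring
  · rw [if_pos le_rfl, if_pos rfl, if_neg (by omega)]
    simp [mul_comm]
  · rw [if_neg (by omega), if_neg (by omega), if_neg (by omega)]
    ring

/-- The recursion is solved downwards from z_{e_i}: the increment of z_j is ε ∑_{c > j} ζ_c
(s/t)^{c−j}. -/
theorem isChart_chartT (hM : ∀ i, e i ≤ M) : IsChart e ζ (tVar K k ^ M) (chartT e M ζ) := by
  rintro ⟨i, j⟩
  have hj := j.2
  have hi := hM i
  have h : tVar K k ^ M * C (ζ i ((j : ℕ) + 1)) = ∑ c ∈ Finset.range (e i + 1),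
      if c = (j : ℕ) + 1 then tVar K k ^ M * C (ζ i c) else 0 := by
    rw [Finset.sum_ite_eq' , if_pos (Finset.mem_range.2 (by omega))]
  simp only [chartT, h]
  rw [← Finset.sum_add_distrib, Finset.mul_sum, Finset.mul_sum]
  refine Finset.sum_congr rfl fun c hc => ?_
  have hc := Finset.mem_range.1 hc
  simp only [Fin.val_succ, Fin.val_castSucc]
  rcases lt_trichotomy c ((j : ℕ) + 1) with h1 | rfl | h1
  · rw [if_pos h1.le, if_neg h1.ne, if_pos (by omega)]
    ring
  · rw [if_pos le_rfl, if_pos rfl, if_neg (by omega),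
      show (j : ℕ) + 1 - j = 1 by omega]
    obtain ⟨N, rfl⟩ : ∃ N, M = N + 1 := ⟨M - 1, by omega⟩
    rw [show N + 1 + (j : ℕ) - (j + 1) = N by omega]
    ring
  · rw [if_neg (by omega), if_neg (by omega), if_neg (by omega),
      show M + ((j : ℕ) + 1) - c = M + j - c + 1 by omega,
      show c - (j : ℕ) = c - (j + 1) + 1 by omega]
    ring

/-- For each c exactly one chart contributes, and in both cases the term is ζ_c s^{e_i−j} t^j ·
s^{c−e_i} t^{−c} after division by s^M t^M. The last factor does not depend on j, which is why the
difference is a vector field. -/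
theorem chartT_sub_chartS (hM : ∀ i, e i ≤ M) (v : ScrollVar e) :
    sVar K k ^ M * chartT e M ζ v - tVar K k ^ M * chartS e M ζ v =
      fibreDeriv (glueCoeff e M ζ) (param K e (X v)) := by
  obtain ⟨i, j⟩ := v
  have hj := j.2
  have hi := hM i
  rw [param_X, mul_assoc, mul_comm (zVar K _), fibreDeriv_pow_mul, fibreDeriv_zVar, glueCoeff, chartT, chartS,
    Finset.mul_sum, Finset.mul_sum, Finset.mul_sum, ← Finset.sum_sub_distrib]
  refine Finset.sum_congr rfl fun c hc => ?_
  have hc : c < e i + 1 := Finset.mem_range.1 hc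
  simp only
  split_ifs with h
  · have h1 : sVar K k ^ (M + c - j) = sVar K k ^ (e i - j) * sVar K k ^ (M + c - e i) := by
      rw [← pow_add]; congr 1; omega
    have h2 : tVar K k ^ M * tVar K k ^ ((j : ℕ) - c) =
        tVar K k ^ (j : ℕ) * tVar K k ^ (M - c) := by
      rw [← pow_add, ← pow_add]; congr 1; omega
    rw [h1]
    linear_combination C (ζ i c) * sVar K k ^ (e i - j) * sVar K k ^ (M + c - e i) * h2
  · have h1 : tVar K k ^ (M + j - c) = tVar K k ^ (j : ℕ) * tVar K k ^ (M - c) := by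
      rw [← pow_add]; congr 1; omega
    have h2 : sVar K k ^ M * sVar K k ^ (c - (j : ℕ)) =
        sVar K k ^ (e i - j) * sVar K k ^ (M + c - e i) := by
      rw [← pow_add, ← pow_add]; congr 1; omega
    rw [h1]
    linear_combination C (ζ i c) * tVar K k ^ (j : ℕ) * tVar K k ^ (M - c) * h2

theorem isWeightedHomogeneous_sVar_pow (w : Fin 2 ⊕ Fin k → ℤ) (n : ℕ) :
    IsWeightedHomogeneous w (sVar K k ^ n) (n * w (Sum.inl 0)) := by
  rw [← nsmul_eq_mul]; exact (isWeightedHomogeneous_X K w _).pow n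

theorem isWeightedHomogeneous_tVar_pow (w : Fin 2 ⊕ Fin k → ℤ) (n : ℕ) :
    IsWeightedHomogeneous w (tVar K k ^ n) (n * w (Sum.inl 1)) := by
  rw [← nsmul_eq_mul]; exact (isWeightedHomogeneous_X K w _).pow n

theorem isWeightedHomogeneous_C_mul_pow_mul_pow (w : Fin 2 ⊕ Fin k → ℤ)
    (hw : w (Sum.inl 0) = w (Sum.inl 1)) (c : K) (m n : ℕ) :
    IsWeightedHomogeneous w (C c * sVar K k ^ m * tVar K k ^ n) ((m + n) * w (Sum.inl 0)) := by
  have h := ((isWeightedHomogeneous_C w c).mul (isWeightedHomogeneous_sVar_pow w m)).mul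
    (isWeightedHomogeneous_tVar_pow w n)
  rwa [zero_add, ← hw, ← add_mul] at h

theorem isWeightedHomogeneous_chartS (hM : ∀ i, e i ≤ M) (w : Fin 2 ⊕ Fin k → ℤ)
    (hw : w (Sum.inl 0) = w (Sum.inl 1)) (v : ScrollVar e) :
    IsWeightedHomogeneous w (chartS e M ζ v) (M * w (Sum.inl 0)) := by
  have hi := hM v.1
  have hj := v.2.2
  refine IsWeightedHomogeneous.sum _ _ _ fun c hc => ?_
  split_ifs with h
  · refine IsWeightedHomogeneous.neg ?_
    convert isWeightedHomogeneous_C_mul_pow_mul_pow w hw _ _ _ using 2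
    omega
  · exact isWeightedHomogeneous_zero _ _ _

theorem isWeightedHomogeneous_chartT (hM : ∀ i, e i ≤ M) (w : Fin 2 ⊕ Fin k → ℤ)
    (hw : w (Sum.inl 0) = w (Sum.inl 1)) (v : ScrollVar e) :
    IsWeightedHomogeneous w (chartT e M ζ v) (M * w (Sum.inl 0)) := by
  have hi := hM v.1
  refine IsWeightedHomogeneous.sum _ _ _ fun c hc => ?_
  have hc := Finset.mem_range.1 hc
  split_ifs with h
  · exact isWeightedHomogeneous_zero _ _ _
  · convert isWeightedHomogeneous_C_mul_pow_mul_pow w hw _ _ _ using 2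
    omega

/-- The derivatives in the two charts differ by the vertical vector field. -/
theorem derivAlong_chartT_sub_chartS (hM : ∀ i, e i ≤ M) (F : MvPolynomial (ScrollVar e) K) :
    sVar K k ^ M * derivAlong e (chartT e M ζ) F - tVar K k ^ M * derivAlong e (chartS e M ζ) F =
      fibreDeriv (glueCoeff e M ζ) (param K e F) := by
  rw [derivation_param]
  simp only [derivAlong, Finset.mul_sum, ← Finset.sum_sub_distrib, ← chartT_sub_chartS ζ hM]
  exact Finset.sum_congr rfl fun v _ => by ring

end Charts

/-! ### Coefficients of the cocycle: the lifting forms. -/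

section Coefficients

variable {k : ℕ} {e : Fin k → ℕ} {K : Type*} [CommRing K]

/-- The exponent of `s^x t^y z^I`. -/
noncomputable def coxExp (x y : ℕ) (I : Fin k → ℕ) : Fin 2 ⊕ Fin k →₀ ℕ :=
  Finsupp.equivFunOnFinite.symm (Sum.elim ![x, y] I)

theorem eq_coxExp (d : Fin 2 ⊕ Fin k →₀ ℕ) :
    d = coxExp (d (Sum.inl 0)) (d (Sum.inl 1)) (fun i => d (Sum.inr i)) := by
  ext y
  rcases y with y | y
  · fin_cases y <;> simp [coxExp]
  · simp [coxExp]

theorem coxExp_inj {x y x' y' : ℕ} {I I' : Fin k → ℕ} :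
    coxExp x y I = coxExp x' y' I' ↔ x = x' ∧ y = y' ∧ I = I' := by
  constructor
  · intro h
    exact ⟨by simpa [coxExp] using DFunLike.congr_fun h (Sum.inl 0),
      by simpa [coxExp] using DFunLike.congr_fun h (Sum.inl 1),
      funext fun i => by simpa [coxExp] using DFunLike.congr_fun h (Sum.inr i)⟩
  · rintro ⟨rfl, rfl, rfl⟩; rfl

theorem coxExp_add (x y x' y' : ℕ) (I I' : Fin k → ℕ) :
    coxExp x y I + coxExp x' y' I' = coxExp (x + x') (y + y') (I + I') := by
  ext z
  rcases z with z | z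
  · fin_cases z <;> simp [coxExp]
  · simp [coxExp]

theorem C_mul_sVar_pow_mul_tVar_pow_mul_prod (c : K) (x y : ℕ) (I : Fin k → ℕ) :
    C c * sVar K k ^ x * tVar K k ^ y * ∏ l, zVar K l ^ I l = monomial (coxExp x y I) c := by
  rw [monomial_eq, Finsupp.prod_fintype _ _ (by simp), Fintype.prod_sum_type, Fin.prod_univ_two]
  simp [coxExp, sVar, tVar, zVar, mul_assoc]

theorem C_mul_sVar_pow_mul_tVar_pow (c : K) (x y : ℕ) :
    C c * sVar K k ^ x * tVar K k ^ y = monomial (coxExp x y (0 : Fin k → ℕ)) c := by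
  rw [← C_mul_sVar_pow_mul_tVar_pow_mul_prod]
  simp

theorem coeff_divisorEq (a b : ℕ) (p : (Fin k → ℕ) → ℕ → K) (x y : ℕ) (I : Fin k → ℕ) :
    coeff (coxExp x y I) (divisorEq e a b p) =
      if ∑ l, I l = a ∧ x + y + b = pairing e I then p I y else 0 := by
  simp only [divisorEq, C_mul_sVar_pow_mul_tVar_pow_mul_prod, coeff_sum, coeff_monomial, coxExp_inj]
  split_ifs with h
  · rw [Finset.sum_eq_single I, Finset.sum_eq_single y]
    · rw [if_pos ⟨by omega, rfl, rfl⟩]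
    · intro j _ hj
      exact if_neg fun h' => hj h'.2.1
    · intro hy
      rw [Finset.mem_range] at hy
      omega
    · intro I' _ hI'
      exact Finset.sum_eq_zero fun j _ => if_neg fun h' => hI' h'.2.2
    · intro hI
      exact absurd (Finset.mem_piAntidiag.2 ⟨h.1, by simp⟩) hI
  · refine Finset.sum_eq_zero fun I' hI' => Finset.sum_eq_zero fun j hj => if_neg ?_
    rintro ⟨h1, rfl, rfl⟩
    rw [Finset.mem_range] at hj
    exact h ⟨(Finset.mem_piAntidiag.1 hI').1, by omega⟩

theorem pairing_add (e I J : Fin k → ℕ) : pairing e (I + J) = pairing e I + pairing e J := by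
  simp [pairing, mul_add, Finset.sum_add_distrib]

theorem pairing_single (e : Fin k → ℕ) (l : Fin k) : pairing e (Pi.single l 1) = e l := by
  simp [pairing, Pi.single_apply]

theorem isWeightedHomogeneous_wt_divisorEq (a b : ℕ) (p : (Fin k → ℕ) → ℕ → K) :
    IsWeightedHomogeneous (wt e) (divisorEq e a b p) (-b) := by
  intro d hd
  rw [eq_coxExp d, coeff_divisorEq] at hd
  have h := (ite_ne_right_iff.1 hd).1.2
  rw [pairing] at h
  zify at h
  rw [weight_wt]
  linarith

theorem isWeightedHomogeneous_zwt_divisorEq (a b : ℕ) (p : (Fin k → ℕ) → ℕ → K) :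
    IsWeightedHomogeneous (zwt k) (divisorEq e a b p) a := by
  intro d hd
  rw [eq_coxExp d, coeff_divisorEq] at hd
  have h := (ite_ne_right_iff.1 hd).1.1
  zify at h
  rw [weight_zwt, h]

theorem coeff_pderiv_divisorEq (a b : ℕ) (p : (Fin k → ℕ) → ℕ → K) (l : Fin k) (x y : ℕ)
    (I : Fin k → ℕ) :
    coeff (coxExp x y I) (pderiv (Sum.inr l) (divisorEq e a b p)) =
      if ∑ i, I i + 1 = a ∧ x + y + b = pairing e I + e l then
        ((I l : K) + 1) * p (I + Pi.single l 1) y else 0 := by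
  have h : coxExp x y I + Finsupp.single (Sum.inr l) 1 = coxExp x y (I + Pi.single l 1) := by
    ext z
    rcases z with z | z
    · fin_cases z <;> simp [coxExp]
    · simp [coxExp, Finsupp.single_apply, Pi.single_apply, eq_comm]
  rw [coeff_pderiv, h, coeff_divisorEq, pairing_add, pairing_single]
  have h2 : ∑ i, (I + Pi.single l 1 : Fin k → ℕ) i = ∑ i, I i + 1 := by
    simp [Finset.sum_add_distrib]
  have h3 : coxExp x y I (Sum.inr l) = I l := by simp [coxExp]
  rw [h2, h3]
  split_ifs
  · ring
  · ring

theorem coeff_pow_mul_pow_mul (c : K) (m n x y : ℕ) (I : Fin k → ℕ) (F : CoxRing K k) :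
    coeff (coxExp x y I) (C c * sVar K k ^ m * tVar K k ^ n * F) =
      if m ≤ x ∧ n ≤ y then c * coeff (coxExp (x - m) (y - n) I) F else 0 := by
  rw [C_mul_sVar_pow_mul_tVar_pow]
  split_ifs with h
  · have : coxExp x y I = coxExp m n 0 + coxExp (x - m) (y - n) I := by
      rw [coxExp_add, coxExp_inj, zero_add]
      exact ⟨by omega, by omega, rfl⟩
    rw [this, coeff_monomial_mul]
  · rw [coeff_monomial_mul', if_neg]
    intro hle
    refine h ⟨?_, ?_⟩
    · simpa [coxExp] using hle (Sum.inl 0)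
    · simpa [coxExp] using hle (Sum.inl 1)

/-- The lifting forms are the coefficients of the vertical derivative of the divisor at the
monomials `s^x t^y z^I` with `x, y < M`. -/
theorem coeff_fibreDeriv_divisorEq {a b M : ℕ} (ha : 1 ≤ a) (hM : ∀ i, e i ≤ M) (hb : b ≤ M)
    (p : (Fin k → ℕ) → ℕ → K) (ζ : Fin k → ℕ → K) {I : Fin k → ℕ}
    (hI : ∑ i, I i = a - 1) {n : ℕ} (hn : 0 < n) (hnb : n < b - pairing e I) :
    coeff (coxExp (M + pairing e I + n - b) (M - n) I)
      (fibreDeriv (glueCoeff e M ζ) (divisorEq e a b p)) = liftingForm e b p ζ I n := by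
  rw [fibreDeriv_apply, coeff_sum, liftingForm]
  refine Finset.sum_congr rfl fun l _ => ?_
  have hl := hM l
  rw [glueCoeff, Finset.sum_mul, coeff_sum]
  simp only [coeff_pow_mul_pow_mul, coeff_pderiv_divisorEq, pairing_add, pairing_single]
  symm
  -- The variable index is c = j + n. From n < b − ⟨e,I⟩ and j ≤ ⟨e,I⟩ + e_l − b one gets c < e_l;
  -- every other c fails an exponent bound and contributes zero.
  refine Finset.sum_of_injOn (fun j => j + n) (fun _ _ _ _ h => by simpa using h) ?_ ?_ ?_
  · intro j hj
    simp only [Finset.coe_range, Set.mem_Iio] at hj ⊢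
    omega
  · intro c hc hc'
    rw [Finset.mem_range] at hc
    split_ifs with h1 h2
    · refine absurd ⟨c - n, ?_, ?_⟩ hc'
      · simp only [Finset.coe_range, Set.mem_Iio]
        omega
      · simp only
        omega
    · rw [mul_zero]
    · rfl
  · intro j hj
    rw [Finset.mem_range] at hj
    rw [if_pos ⟨by omega, by omega⟩, if_pos ⟨by omega, by omega⟩,
      show M - n - (M - (j + n)) = j by omega]
    ring

end Coefficients

/-! ### Flatness of the deformed ideal. -/

section Flatness

variable {k : ℕ} {e : Fin k → ℕ} {K : Type*} [Field K]

/-- The deformed ideal. -/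
noncomputable def deformedIdeal {b : ℕ} (e : Fin k → ℕ) (ζ : Fin k → ℕ → K)
    (Pm Pm' : Fin (b + 1) → MvPolynomial (ScrollVar e) K) :
    Ideal (MvPolynomial (ScrollVar e) (DualNumber K)) :=
  minorIdeal (deformedMatrix e ζ) ⊔ Ideal.span (Set.range fun m => perturb (Pm m) (Pm' m))

theorem flat_quotient_iff {σ : Type*} (I : Ideal (MvPolynomial σ (DualNumber K))) :
    Module.Flat (DualNumber K) (MvPolynomial σ (DualNumber K) ⧸ I) ↔
      ∀ F, C DualNumber.eps * F ∈ I → ∃ G, F - C DualNumber.eps * G ∈ I := by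
  rw [flat_dualNumber_iff]
  have hsmul : ∀ F, (DualNumber.eps : DualNumber K) • Ideal.Quotient.mk I F =
      Ideal.Quotient.mk I (C DualNumber.eps * F) := by
    intro F
    rw [← smul_eq_C_mul]
    rfl
  constructor
  · intro h F hF
    obtain ⟨y, hy⟩ := h (Ideal.Quotient.mk I F)
      (by rw [hsmul, Ideal.Quotient.eq_zero_iff_mem]; exact hF)
    obtain ⟨G, rfl⟩ := Ideal.Quotient.mk_surjective y
    rw [hsmul] at hy
    exact ⟨G, (Ideal.Quotient.mk_eq_mk_iff_sub_mem _ _).1 hy⟩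
  · intro h x hx
    obtain ⟨F, rfl⟩ := Ideal.Quotient.mk_surjective x
    rw [hsmul, Ideal.Quotient.eq_zero_iff_mem] at hx
    obtain ⟨G, hG⟩ := h F hx
    exact ⟨Ideal.Quotient.mk I G, by
      rw [hsmul]; exact (Ideal.Quotient.mk_eq_mk_iff_sub_mem _ _).2 hG⟩

theorem redEps_deformedMatrix (ζ : Fin k → ℕ → K) (i : Fin 2) (α : ScrollCol e) :
    redEps K _ (deformedMatrix e ζ i α) = scrollMatrix e (0 : Fin k → ℕ → K) i α := by
  fin_cases i
  · exact (congrArg _ (deformedMatrix_zero ζ α)).trans (redEps_perturb _ _)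
  · exact (congrArg _ (deformedMatrix_one ζ α)).trans (redEps_perturb _ _)

theorem redEps_surjective (σ : Type*) : Function.Surjective (redEps K σ) :=
  fun F => ⟨perturb F 0, redEps_perturb F 0⟩

theorem le_map_redEps_deformedIdeal {b : ℕ} (ζ : Fin k → ℕ → K)
    (Pm Pm' : Fin (b + 1) → MvPolynomial (ScrollVar e) K) :
    minorIdeal (scrollMatrix e (0 : Fin k → ℕ → K)) ⊔ Ideal.span (Set.range Pm) ≤
      (deformedIdeal e ζ Pm Pm').map (redEps K _) := by
  refine sup_le (Ideal.span_le.2 ?_) (Ideal.span_le.2 ?_)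
  · rintro _ ⟨α, β, rfl⟩
    have h : deformedMatrix e ζ 0 α * deformedMatrix e ζ 1 β -
        deformedMatrix e ζ 1 α * deformedMatrix e ζ 0 β ∈ deformedIdeal e ζ Pm Pm' :=
      Ideal.mem_sup_left (Ideal.subset_span ⟨α, β, rfl⟩)
    have := Ideal.mem_map_of_mem (redEps K _) h
    rw [SetLike.mem_coe]
    simpa only [map_sub, map_mul, redEps_deformedMatrix] using this
  · rintro _ ⟨m, rfl⟩
    have h : perturb (Pm m) (Pm' m) ∈ deformedIdeal e ζ Pm Pm' :=
      Ideal.mem_sup_right (Ideal.subset_span ⟨m, rfl⟩)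
    have := Ideal.mem_map_of_mem (redEps K _) h
    rwa [redEps_perturb] at this

theorem dvd_of_mem_deformedIdeal {b : ℕ} {ζ : Fin k → ℕ → K}
    {Pm Pm' : Fin (b + 1) → MvPolynomial (ScrollVar e) K} {P : CoxRing K k}
    (hP : ∀ m, P ∣ param K e (Pm m))
    {F : MvPolynomial (ScrollVar e) (DualNumber K)} (hF : F ∈ deformedIdeal e ζ Pm Pm') :
    P ∣ param K e (redEps K _ F) := by
  have h : deformedIdeal e ζ Pm Pm' ≤
      (Ideal.span {P}).comap ((param K e).toRingHom.comp (redEps K _)) := by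
    refine sup_le (Ideal.span_le.2 ?_) (Ideal.span_le.2 ?_)
    · rintro _ ⟨α, β, rfl⟩
      rw [SetLike.mem_coe, Ideal.mem_comap, Ideal.mem_span_singleton]
      simp only [RingHom.comp_apply, map_sub, map_mul, redEps_deformedMatrix]
      have : param K e (scrollMatrix e (0 : Fin k → ℕ → K) 0 α) *
          param K e (scrollMatrix e (0 : Fin k → ℕ → K) 1 β) -
          param K e (scrollMatrix e (0 : Fin k → ℕ → K) 1 α) *
          param K e (scrollMatrix e (0 : Fin k → ℕ → K) 0 β) = 0 := by
        refine (mul_eq_zero.1 ?_).resolve_left (sVar_ne_zero (K := K) (k := k))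
        linear_combination (param K e (scrollMatrix e (0 : Fin k → ℕ → K) 0 α)) *
          param_rows (K := K) e β - (param K e (scrollMatrix e (0 : Fin k → ℕ → K) 0 β)) *
          param_rows (K := K) e α
      exact Dvd.intro_left 0 (by rw [zero_mul]; exact this.symm)
    · rintro _ ⟨m, rfl⟩
      rw [SetLike.mem_coe, Ideal.mem_comap, Ideal.mem_span_singleton, RingHom.comp_apply,
        redEps_perturb]
      exact hP m
  exact Ideal.mem_span_singleton.1 (h hF)

/-- If the equations of a deformation are multiples of a deformation of `P` in a chart, then `P`
divides every element of the ideal that is divisible by `ε`. -/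
theorem dvd_snd_chart {b : ℕ} {ζ : Fin k → ℕ → K} {u : CoxRing K k}
    {d : ScrollVar e → CoxRing K k} (hd : IsChart e ζ u d)
    {Pm Pm' : Fin (b + 1) → MvPolynomial (ScrollVar e) K} {P h : CoxRing K k} (hP : P ≠ 0)
    (hPm : ∀ m, TrivSqZeroExt.inl P + TrivSqZeroExt.inr h ∣
      chart e u d (perturb (Pm m) (Pm' m)))
    {F : MvPolynomial (ScrollVar e) K} (hF : perturb 0 F ∈ deformedIdeal e ζ Pm Pm') :
    P ∣ u * param K e F := by
  have hle : deformedIdeal e ζ Pm Pm' ≤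
      (Ideal.span {TrivSqZeroExt.inl P + TrivSqZeroExt.inr h}).comap (chart e u d) := by
    refine sup_le (fun G hG => ?_) (Ideal.span_le.2 ?_)
    · rw [Ideal.mem_comap, chart_eq_zero_of_mem_minorIdeal hd hG]
      exact zero_mem _
    · rintro _ ⟨m, rfl⟩
      rw [SetLike.mem_coe, Ideal.mem_comap, Ideal.mem_span_singleton]
      exact hPm m
  obtain ⟨Q, hQ⟩ := Ideal.mem_span_singleton.1 (hle hF)
  have h1 := congrArg TrivSqZeroExt.fst hQ
  have h2 := congrArg TrivSqZeroExt.snd hQ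
  rw [fst_chart_perturb] at h1
  rw [snd_chart_perturb] at h2
  simp [hP] at h1
  rw [← C_0, derivAlong_C] at h2
  simp [h1] at h2
  exact ⟨_, h2⟩

theorem flat_of_charts {b M : ℕ} {ζ : Fin k → ℕ → K} {dS dT : ScrollVar e → CoxRing K k}
    (hS : IsChart e ζ (sVar K k ^ M) dS) (hT : IsChart e ζ (tVar K k ^ M) dT)
    {Pm Pm' : Fin (b + 1) → MvPolynomial (ScrollVar e) K} {P h h' : CoxRing K k} (hP : P ≠ 0)
    (hPw : IsWeightedHomogeneous (wt e) P (-b))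
    (hPm : ∀ m, param K e (Pm m) = sVar K k ^ (b - (m : ℕ)) * tVar K k ^ (m : ℕ) * P)
    (hPS : ∀ m, TrivSqZeroExt.inl P + TrivSqZeroExt.inr h ∣
      chart e (sVar K k ^ M) dS (perturb (Pm m) (Pm' m)))
    (hPT : ∀ m, TrivSqZeroExt.inl P + TrivSqZeroExt.inr h' ∣
      chart e (tVar K k ^ M) dT (perturb (Pm m) (Pm' m))) :
    Module.Flat (DualNumber K)
      (MvPolynomial (ScrollVar e) (DualNumber K) ⧸ deformedIdeal e ζ Pm Pm') := by
  rw [flat_quotient_iff]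
  intro F hF
  obtain ⟨F', hF'⟩ := exists_eq_perturb F
  set f := redEps K _ F with hf
  have hεF : C DualNumber.eps * F = perturb 0 f := by
    rw [hF', perturb, perturb_zero_left]
    linear_combination (MvPolynomial.map (algebraMap K (DualNumber K)) F') *
      C_eps_mul_C_eps (K := K) (σ := ScrollVar e)
  rw [hεF] at hF
  obtain ⟨Q₁, hQ₁⟩ := dvd_snd_chart hS hP hPS hF
  obtain ⟨Q₂, hQ₂⟩ := dvd_snd_chart hT hP hPT hF
  -- P divides both s^M f and t^M f; since s and t are coprime, it divides f itself.
  have hQ : tVar K k ^ M * Q₁ = sVar K k ^ M * Q₂ := by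
    refine mul_left_cancel₀ hP ?_
    linear_combination sVar K k ^ M * hQ₂ - tVar K k ^ M * hQ₁
  have hsp : Prime (sVar K k) := X_prime
  obtain ⟨Q, rfl⟩ : sVar K k ^ M ∣ Q₁ :=
    hsp.pow_dvd_of_dvd_mul_left _ (fun h => not_sVar_dvd_tVar (hsp.dvd_of_dvd_pow h)) ⟨_, hQ⟩
  have hfQ : param K e f = Q * P := by
    refine mul_left_cancel₀ (pow_ne_zero M (sVar_ne_zero (K := K) (k := k))) ?_
    rw [hQ₁]; ring
  obtain ⟨Q', hQ'w, hQ'⟩ := exists_isWeightedHomogeneous_mul_eq (wt e) (Q := Q) (n := (b : ℤ)) hPw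
    (by rw [← hfQ, add_neg_cancel]; exact isWeightedHomogeneous_wt_param e f)
  obtain ⟨q, hq⟩ := exists_eq_sum_pow_mul_param e hQ'w
  have hfmem : f ∈ minorIdeal (scrollMatrix e (0 : Fin k → ℕ → K)) ⊔
      Ideal.span (Set.range Pm) := by
    have h0 : param K e (f - ∑ m, q m * Pm m) = 0 := by
      rw [map_sub, hfQ, ← hQ', hq, map_sum, Finset.sum_mul, ← Finset.sum_sub_distrib]
      refine Finset.sum_eq_zero fun m _ => ?_
      rw [map_mul, hPm]
      ring
    rw [← sub_add_cancel f (∑ m, q m * Pm m)]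
    refine add_mem (Ideal.mem_sup_left (mem_minorIdeal_of_param_eq_zero e h0))
      (Ideal.mem_sup_right (sum_mem fun m _ => ?_))
    exact Ideal.mul_mem_left _ _ (Ideal.subset_span ⟨m, rfl⟩)
  -- The reduction f lies in the undeformed ideal, so it lifts to some F₁ in the deformed one; F and
  -- F₁ then differ by a multiple of ε.
  obtain ⟨F₁, hF₁, hF₁f⟩ := (Ideal.mem_map_iff_of_surjective _ (redEps_surjective _)).1
    (le_map_redEps_deformedIdeal ζ Pm Pm' hfmem)
  obtain ⟨G, hG⟩ := exists_eq_perturb (F - F₁)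
  rw [map_sub, hF₁f, ← hf, sub_self, perturb_zero_left] at hG
  refine ⟨MvPolynomial.map (algebraMap K (DualNumber K)) G, ?_⟩
  rw [← hG, sub_sub_cancel]
  exact hF₁

end Flatness

/-! ### Sufficiency: constructing a rolling-factors lift. -/

section Lift

variable {k : ℕ} {e : Fin k → ℕ} {K : Type*} [Field K]

theorem exists_deformation {a b : ℕ} (ha : 1 ≤ a) {p : (Fin k → ℕ) → ℕ → K}
    (hP : divisorEq e a b p ≠ 0) {Pm : Fin (b + 1) → MvPolynomial (ScrollVar e) K}
    (hPm : IsRollingEquations e a b (divisorEq e a b p) Pm) {ζ : Fin k → ℕ → K}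
    (hL : ∀ I : Fin k → ℕ, ∑ l, I l = a - 1 → pairing e I < b - 1 →
        ∀ n : ℕ, 0 < n → n < b - pairing e I → liftingForm e b p ζ I n = 0) :
    LiftsRolling e a ζ Pm := by
  set P := divisorEq e a b p with hPdef
  -- Any M bounding b and all e_i would do; it keeps the exponents in both charts non-negative.
  set M := b + ∑ i, e i with hMdef
  have hM : ∀ i, e i ≤ M := fun i =>
    (Finset.single_le_sum (fun _ _ => Nat.zero_le _) (Finset.mem_univ i)).trans
      (Nat.le_add_left _ _)
  have hb : b ≤ M := Nat.le_add_right _ _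
  set E := fibreDeriv (glueCoeff e M ζ) with hE
  -- The bidegree of E(P) is read off from this identity after cancelling s^b.
  have hEP0 : sVar K k ^ b * E P = E (param K e (Pm 0)) := by
    rw [hPm.represents, hE, fibreDeriv_pow_mul]
    simp
  have hw0 : wt e (Sum.inl 0) = 1 := rfl
  have hw1 : wt e (Sum.inl 1) = 1 := rfl
  have hz0 : zwt k (Sum.inl 0) = 0 := rfl
  have hz1 : zwt k (Sum.inl 1) = 0 := rfl
  have hSw : ∀ v, IsWeightedHomogeneous (wt e) (chartS e M ζ v) (M : ℤ) := fun v => by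
    simpa [hw0] using isWeightedHomogeneous_chartS ζ hM (wt e) rfl v
  have hTw : ∀ v, IsWeightedHomogeneous (wt e) (chartT e M ζ v) (M : ℤ) := fun v => by
    simpa [hw0] using isWeightedHomogeneous_chartT ζ hM (wt e) rfl v
  have hSz : ∀ v, IsWeightedHomogeneous (zwt k) (chartS e M ζ v) 0 := fun v => by
    simpa [hz0] using isWeightedHomogeneous_chartS ζ hM (zwt k) rfl v
  have hTz : ∀ v, IsWeightedHomogeneous (zwt k) (chartT e M ζ v) 0 := fun v => by
    simpa [hz0] using isWeightedHomogeneous_chartT ζ hM (zwt k) rfl v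
  have hsX := isWeightedHomogeneous_sVar_pow (K := K) (k := k)
  have htX := isWeightedHomogeneous_tVar_pow (K := K) (k := k)
  have hEw : IsWeightedHomogeneous (wt e) (E P) (2 * M - b) := by
    have h1 : IsWeightedHomogeneous (wt e) (sVar K k ^ b * E P) (b • wt e (Sum.inl 0) + (2 * M - b)) := by
      rw [hEP0, ← derivAlong_chartT_sub_chartS ζ hM]
      refine IsWeightedHomogeneous.sub ?_ ?_
      · convert (hsX (wt e) M).mul (isWeightedHomogeneous_wt_derivAlong hTw (Pm 0)) using 1
        rw [hw0, nsmul_eq_mul]; ring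
      · convert (htX (wt e) M).mul (isWeightedHomogeneous_wt_derivAlong hSw (Pm 0)) using 1
        rw [hw0, hw1, nsmul_eq_mul]; ring
    exact isWeightedHomogeneous_of_pow_X_mul _ h1
  have hEz : IsWeightedHomogeneous (zwt k) (E P) ((a - 1 : ℕ) : ℤ) := by
    have h1 : IsWeightedHomogeneous (zwt k) (sVar K k ^ b * E P)
        (b • zwt k (Sum.inl 0) + ((a - 1 : ℕ) : ℤ)) := by
      rw [hEP0, ← derivAlong_chartT_sub_chartS ζ hM]
      refine IsWeightedHomogeneous.sub ?_ ?_
      · convert (hsX (zwt k) M).mul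
          (isWeightedHomogeneous_zwt_derivAlong hTz (hPm.homogeneous 0)) using 1
        rw [hz0]; simp
      · convert (htX (zwt k) M).mul
          (isWeightedHomogeneous_zwt_derivAlong hSz (hPm.homogeneous 0)) using 1
        rw [hz0, hz1]; simp
    exact isWeightedHomogeneous_of_pow_X_mul _ h1
  -- A monomial s^x t^y z^I of E(P) with x, y < M satisfies x + y = 2M − b + ⟨e,I⟩. With n = M − y
  -- this gives 0 < n < b − ⟨e,I⟩, and its coefficient is a lifting form, assumed zero.
  obtain ⟨h, h', hsplit, hhom⟩ := exists_eq_pow_mul_sub_pow_mul (x := Sum.inl 0) (y := Sum.inl 1)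
    (M := M) (F := E P) (by
      intro d hd
      by_contra hcon
      push Not at hcon
      have h1 := hEw hd
      have h2 := hEz hd
      rw [weight_wt] at h1
      rw [weight_zwt] at h2
      set I : Fin k → ℕ := fun i => d (Sum.inr i) with hIdef
      have hI : ∑ i, I i = a - 1 := by exact_mod_cast h2
      have h1' : (d (Sum.inl 0) : ℤ) + d (Sum.inl 1) - pairing e I = 2 * M - b := by
        rw [← h1, pairing]
        push_cast
        rfl
      rw [eq_coxExp d] at hd
      refine hd ?_
      have h3 := coeff_fibreDeriv_divisorEq ha hM hb p ζ hI (n := M - d (Sum.inl 1))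
        (by omega) (by omega)
      rw [hL I hI (by omega) _ (by omega) (by omega)] at h3
      convert h3 using 3
      · omega
      · omega)
  obtain ⟨hhw, hh'w⟩ := hhom (wt e) _ hEw rfl
  obtain ⟨hhz, hh'z⟩ := hhom (zwt k) _ hEz rfl
  rw [hw0] at hhw hh'w
  rw [hz0, mul_zero, sub_zero] at hhz hh'z
  change _ = sVar K k ^ M * h' - tVar K k ^ M * h at hsplit
  have hsp : Prime (sVar K k) := X_prime
  have hdiff : ∀ m : Fin (b + 1),
      sVar K k ^ M * (derivAlong e (chartT e M ζ) (Pm m) -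
          sVar K k ^ (b - (m : ℕ)) * tVar K k ^ (m : ℕ) * h') =
        tVar K k ^ M * (derivAlong e (chartS e M ζ) (Pm m) -
          sVar K k ^ (b - (m : ℕ)) * tVar K k ^ (m : ℕ) * h) := by
    intro m
    have h1 := derivAlong_chartT_sub_chartS ζ hM (Pm m)
    rw [hPm.represents, fibreDeriv_pow_mul, ← hE, hsplit] at h1
    linear_combination h1
  have hex : ∀ m, ∃ f : MvPolynomial (ScrollVar e) K, f.IsHomogeneous (a - 1) ∧
      derivAlong e (chartS e M ζ) (Pm m) + sVar K k ^ M * param K e f =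
        sVar K k ^ (b - (m : ℕ)) * tVar K k ^ (m : ℕ) * h := by
    intro m
    -- By `hdiff` the equation for P'_m in one chart is equivalent to that in the other, and
    -- coprimality of s and t makes the quotient by s^M polynomial. It has weight zero, hence lies
    -- in the image of the parametrisation.
    obtain ⟨y, hy⟩ : sVar K k ^ M ∣ derivAlong e (chartS e M ζ) (Pm m) -
          sVar K k ^ (b - (m : ℕ)) * tVar K k ^ (m : ℕ) * h :=
      hsp.pow_dvd_of_dvd_mul_left _ (fun h => not_sVar_dvd_tVar (hsp.dvd_of_dvd_pow h))
        ⟨_, (hdiff m).symm⟩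
    have hm := m.2
    have hyw : IsWeightedHomogeneous (wt e) y 0 := by
      refine isWeightedHomogeneous_of_pow_X_mul (wt e) (i := Sum.inl 0) (M := M) ?_
      change IsWeightedHomogeneous _ (sVar K k ^ M * y) _
      rw [← hy, hw0, nsmul_eq_mul, mul_one, add_zero]
      refine (isWeightedHomogeneous_wt_derivAlong hSw _).sub ?_
      convert ((hsX (wt e) _).mul (htX (wt e) _)).mul hhw using 1
      rw [hw0, hw1, Nat.cast_sub (by omega)]
      ring
    have hyz : IsWeightedHomogeneous (zwt k) y ((a - 1 : ℕ) : ℤ) := by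
      refine isWeightedHomogeneous_of_pow_X_mul (zwt k) (i := Sum.inl 0) (M := M) ?_
      change IsWeightedHomogeneous _ (sVar K k ^ M * y) _
      rw [← hy, hz0, smul_zero, zero_add]
      refine (isWeightedHomogeneous_zwt_derivAlong hSz (hPm.homogeneous m)).sub ?_
      convert ((hsX (zwt k) _).mul (htX (zwt k) _)).mul hhz using 1
      rw [hz0, hz1]
      simp
    obtain ⟨f, hf, hfy⟩ := exists_param_eq e hyw hyz
    refine ⟨-f, hf.neg, ?_⟩
    rw [map_neg, hfy]
    linear_combination hy
  choose Pm' hPm'h hPmS using hex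
  have hPmT : ∀ m, derivAlong e (chartT e M ζ) (Pm m) + tVar K k ^ M * param K e (Pm' m) =
        sVar K k ^ (b - (m : ℕ)) * tVar K k ^ (m : ℕ) * h' := by
    intro m
    refine mul_left_cancel₀ (pow_ne_zero M (sVar_ne_zero (K := K) (k := k))) ?_
    linear_combination hdiff m + tVar K k ^ M * hPmS m
  have hcS : IsChart e ζ (sVar K k ^ M) (chartS e M ζ) := isChart_chartS ζ hM
  have hcT : IsChart e ζ (tVar K k ^ M) (chartT e M ζ) := isChart_chartT ζ hM
  refine ⟨Pm', ⟨hPm'h, ?_⟩, ?_⟩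
  · refine flat_of_charts hcS hcT (h := h) (h' := h') hP
      (isWeightedHomogeneous_wt_divisorEq a b p) hPm.represents (fun m => ?_) fun m => ?_
    · refine ⟨TrivSqZeroExt.inl (sVar K k ^ (b - (m : ℕ)) * tVar K k ^ (m : ℕ)), ?_⟩
      rw [chart_perturb, hPm.represents, hPmS]
      apply dualNumber_ext
      · simp; ring
      · simp; ring
    · refine ⟨TrivSqZeroExt.inl (sVar K k ^ (b - (m : ℕ)) * tVar K k ^ (m : ℕ)), ?_⟩
      rw [chart_perturb, hPm.represents, hPmT]
      apply dualNumber_ext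
      · simp; ring
      · simp; ring
  · intro m
    obtain ⟨q, hq0, hq1⟩ := hPm.rolling m
    -- γ is what the old coefficients q produce from the deformed bottom row. Once it is removed,
    -- P'_m and P'_{m+1} have ratio t/s and roll on the undeformed scroll with some r; the deformed
    -- coefficients are q + εr.
    set γ := ∑ α : ScrollCol e, q α * C (ζ α.1 ((α.2 : ℕ) + 1)) with hγ
    have hrow0 : ∑ α, perturb (q α) 0 * deformedMatrix e ζ 0 α = perturb (Pm m.castSucc) 0 := by
      have : perturb (Pm m.castSucc) (∑ α : ScrollCol e, (0 : MvPolynomial (ScrollVar e) K)) =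
          perturb (Pm m.castSucc) 0 := by rw [Finset.sum_const_zero]
      rw [← this, hq0, perturb_sum]
      refine Finset.sum_congr rfl fun α _ => ?_
      rw [deformedMatrix_zero, perturb_mul]
      simp
    have hrow1 : ∑ α, perturb (q α) 0 * deformedMatrix e ζ 1 α = perturb (Pm m.succ) γ := by
      rw [hq1, hγ, perturb_sum]
      refine Finset.sum_congr rfl fun α _ => ?_
      rw [deformedMatrix_one, perturb_mul]
      simp
    have hroll : sVar K k * param K e (Pm' m.succ - γ) = tVar K k * param K e (Pm' m.castSucc) := by
      have h1 : TrivSqZeroExt.inl (sVar K k) *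
          chart e (sVar K k ^ M) (chartS e M ζ) (perturb (Pm m.succ) γ) =
          TrivSqZeroExt.inl (tVar K k) *
          chart e (sVar K k ^ M) (chartS e M ζ) (perturb (Pm m.castSucc) 0) := by
        rw [← hrow0, ← hrow1, map_sum, map_sum, Finset.mul_sum, Finset.mul_sum]
        refine Finset.sum_congr rfl fun α _ => ?_
        rw [map_mul, map_mul]
        linear_combination chart e (sVar K k ^ M) (chartS e M ζ) (perturb (q α) 0) *
          chart_rows hcS α
      have h2 := congrArg TrivSqZeroExt.snd h1
      rw [chart_perturb, chart_perturb] at h2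
      simp at h2
      have h3 := hPmS m.succ
      have h4 := hPmS m.castSucc
      rw [Fin.val_succ] at h3
      rw [Fin.val_castSucc, show b - (m : ℕ) = b - (m + 1) + 1 by have := m.2; omega] at h4
      refine mul_left_cancel₀ (pow_ne_zero M (sVar_ne_zero (K := K) (k := k))) ?_
      rw [map_sub]
      linear_combination sVar K k * h3 - tVar K k * h4 - h2
    obtain ⟨r, hr0, hr1⟩ := exists_rolling e hroll
    refine ⟨fun α => perturb (q α) (r α), ?_, ?_⟩
    · simp only
      rw [hq0, hr0, perturb_sum]
      refine Finset.sum_congr rfl fun α _ => ?_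
      rw [deformedMatrix_zero, perturb_mul]
      simp
    · simp only
      rw [hq1, eq_add_of_sub_eq hr1, hγ, ← Finset.sum_add_distrib, perturb_sum]
      refine Finset.sum_congr rfl fun α _ => ?_
      rw [deformedMatrix_one, perturb_mul, add_comm]

end Lift

/-! ### Necessity of the lifting equations, and the lifting matrix. -/

section Necessity

variable {k : ℕ} {e : Fin k → ℕ} {K : Type*} [Field K]

theorem liftingForm_eq_zero_of_chart {a b M : ℕ} (ha : 1 ≤ a) (hM : ∀ i, e i ≤ M) (hb : b ≤ M)
    {p : (Fin k → ℕ) → ℕ → K} {Pm : Fin (b + 1) → MvPolynomial (ScrollVar e) K}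
    (hPm : IsRollingEquations e a b (divisorEq e a b p) Pm) {ζ : Fin k → ℕ → K}
    (Pm' : Fin (b + 1) → MvPolynomial (ScrollVar e) K)
    (hT : ∀ m : Fin b,
      TrivSqZeroExt.inl (sVar K k) *
          chart e (tVar K k ^ M) (chartT e M ζ) (perturb (Pm m.succ) (Pm' m.succ)) =
        TrivSqZeroExt.inl (tVar K k) *
          chart e (tVar K k ^ M) (chartT e M ζ) (perturb (Pm m.castSucc) (Pm' m.castSucc)))
    {I : Fin k → ℕ} (hI : ∑ i, I i = a - 1) {n : ℕ} (hn : 0 < n) (hnb : n < b - pairing e I) :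
    liftingForm e b p ζ I n = 0 := by
  set G : Fin (b + 1) → CoxRing K k := fun m =>
    (chart e (tVar K k ^ M) (chartT e M ζ) (perturb (Pm m) (Pm' m))).snd with hG
  have hstep : ∀ m : Fin b, sVar K k * G m.succ = tVar K k * G m.castSucc := fun m => by
    simpa using congrArg TrivSqZeroExt.snd (hT m)
  have hpow : ∀ m : Fin (b + 1), sVar K k ^ (m : ℕ) * G m = tVar K k ^ (m : ℕ) * G 0 := by
    intro m
    induction m using Fin.induction with
    | zero => simp
    | succ m ih =>
      rw [Fin.val_succ]
      rw [Fin.val_castSucc] at ih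
      linear_combination sVar K k ^ (m : ℕ) * hstep m + tVar K k * ih
  have hlast := hpow (Fin.last b)
  rw [Fin.val_last] at hlast
  have h0 : G 0 = derivAlong e (chartT e M ζ) (Pm 0) + tVar K k ^ M * param K e (Pm' 0) :=
    snd_chart_perturb _ _ _ _
  set H := derivAlong e (chartS e M ζ) (Pm 0) + sVar K k ^ M * param K e (Pm' 0) with hH
  have hglue := derivAlong_chartT_sub_chartS ζ hM (Pm 0)
  rw [hPm.represents, fibreDeriv_pow_mul] at hglue
  simp only [Fin.val_zero, Nat.sub_zero, pow_zero, mul_one] at hglue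
  -- In the gluing identity s^M t^b G_0 becomes s^{b+M} G_b, and the terms with P'_0 cancel between
  -- the charts.
  have hkey : C 1 * sVar K k ^ b * tVar K k ^ b *
        fibreDeriv (glueCoeff e M ζ) (divisorEq e a b p) =
      C 1 * sVar K k ^ (b + M) * tVar K k ^ 0 * G (Fin.last b) -
        C 1 * sVar K k ^ 0 * tVar K k ^ (b + M) * H := by
    rw [C_1, pow_add, pow_add]
    linear_combination -(tVar K k ^ b) * hglue - sVar K k ^ M * hlast +
      sVar K k ^ M * tVar K k ^ b * (-h0) - tVar K k ^ b * tVar K k ^ M * hH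
  -- Both exponents are below b + M, by n < b − ⟨e,I⟩ for s and by n > 0 for t, so neither term on
  -- the right contributes.
  have hc := congrArg (coeff (coxExp (b + (M + pairing e I + n - b)) (b + (M - n)) I)) hkey
  rw [coeff_sub, coeff_pow_mul_pow_mul, coeff_pow_mul_pow_mul, coeff_pow_mul_pow_mul,
    if_pos ⟨by omega, by omega⟩, if_neg (by omega), if_neg (by omega), one_mul, sub_zero,
    Nat.add_sub_cancel_left, Nat.add_sub_cancel_left,
    coeff_fibreDeriv_divisorEq ha hM hb p ζ hI hn hnb] at hc
  exact hc

/-- The syzygies of the equations force every flat deformation to be compatible with the rolling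
factors format on the deformed scroll. -/
theorem exists_row_mul_eq {a b : ℕ} {P : CoxRing K k}
    {Pm Pm' : Fin (b + 1) → MvPolynomial (ScrollVar e) K}
    (hPm : IsRollingEquations e a b P Pm) {ζ : Fin k → ℕ → K}
    (hdef : IsDeformation e a ζ Pm Pm') {u : CoxRing K k} {d : ScrollVar e → CoxRing K k}
    (hd : IsChart e ζ u d) (m : Fin b) (α : ScrollCol e) :
    ∃ c, param K e (scrollMatrix e (0 : Fin k → ℕ → K) 0 α) *
        (sVar K k * (chart e u d (perturb (Pm m.succ) (Pm' m.succ))).snd -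
          tVar K k * (chart e u d (perturb (Pm m.castSucc) (Pm' m.castSucc))).snd) =
      sVar K k * u * (P * c) := by
  obtain ⟨q, hq0, hq1⟩ := hPm.rolling m
  set A := deformedMatrix e ζ with hA
  set S : MvPolynomial (ScrollVar e) (DualNumber K) :=
    ∑ β, perturb (q β) 0 * (A 0 α * A 1 β - A 1 α * A 0 β) with hS
  have hSmem : S ∈ minorIdeal A :=
    sum_mem fun β _ => Ideal.mul_mem_left _ _ (Ideal.subset_span ⟨α, β, rfl⟩)
  -- The syzygy x_α P_{m+1} − y_α P_m = ∑ q_β (x_α y_β − y_α x_β), evaluated on the deformed data.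
  -- It holds modulo ε, so F = εF'.
  set F := A 0 α * perturb (Pm m.succ) (Pm' m.succ) -
    A 1 α * perturb (Pm m.castSucc) (Pm' m.castSucc) - S with hF
  have hFmem : F ∈ deformedIdeal e ζ Pm Pm' := by
    have hmem : ∀ m, perturb (Pm m) (Pm' m) ∈ deformedIdeal e ζ Pm Pm' := fun m =>
      Ideal.mem_sup_right (Ideal.subset_span ⟨m, rfl⟩)
    exact sub_mem (sub_mem (Ideal.mul_mem_left _ _ (hmem _)) (Ideal.mul_mem_left _ _ (hmem _)))
      (Ideal.mem_sup_left hSmem)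
  have hred : redEps K _ F = 0 := by
    rw [hF, hS, map_sub, map_sub, map_mul, map_mul, map_sum, redEps_perturb, redEps_perturb, hq0,
      hq1, Finset.mul_sum, Finset.mul_sum, ← Finset.sum_sub_distrib, ← Finset.sum_sub_distrib]
    refine Finset.sum_eq_zero fun β _ => ?_
    simp only [map_mul, map_sub, redEps_perturb, hA, redEps_deformedMatrix]
    ring
  obtain ⟨F', hF'⟩ := exists_eq_perturb F
  rw [hred] at hF'
  have hflat := (flat_quotient_iff _).1 hdef.2
  -- Flatness puts F' into the undeformed ideal, hence P divides its image under the
  -- parametrisation.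
  obtain ⟨G, hG⟩ := hflat (MvPolynomial.map (algebraMap K (DualNumber K)) F')
    (by rw [← perturb_zero_left, ← hF']; exact hFmem)
  obtain ⟨c, hc⟩ := dvd_of_mem_deformedIdeal (P := P)
    (fun m => ⟨_, (hPm.represents m).trans (mul_comm _ _)⟩) hG
  have hred' : redEps K _ (MvPolynomial.map (algebraMap K (DualNumber K)) F' -
      C DualNumber.eps * G) = F' := by
    have h1 := redEps_perturb F' 0
    rw [perturb, map_zero, mul_zero, add_zero] at h1
    rw [map_sub, map_mul, h1, redEps_C, DualNumber.fst_eps, C_0, zero_mul, sub_zero]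
  rw [hred'] at hc
  refine ⟨c, ?_⟩
  have h1 : TrivSqZeroExt.inl (sVar K k) * chart e u d F = chart e u d (A 0 α) *
      (TrivSqZeroExt.inl (sVar K k) * chart e u d (perturb (Pm m.succ) (Pm' m.succ)) -
        TrivSqZeroExt.inl (tVar K k) *
          chart e u d (perturb (Pm m.castSucc) (Pm' m.castSucc))) := by
    rw [hF, map_sub, map_sub, map_mul, map_mul, chart_eq_zero_of_mem_minorIdeal hd hSmem]
    linear_combination -(chart e u d (perturb (Pm m.castSucc) (Pm' m.castSucc))) *
      chart_rows hd α
  have h2 := congrArg TrivSqZeroExt.snd h1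
  have hz : derivAlong e d 0 = 0 := by rw [← C_0, derivAlong_C]
  have h3 : sVar K k * param K e (Pm m.succ) = tVar K k * param K e (Pm m.castSucc) := by
    rw [hPm.represents, hPm.represents, Fin.val_succ, Fin.val_castSucc,
      show b - (m : ℕ) = b - (m + 1) + 1 by have := m.2; omega]
    ring
  rw [hF', hA, deformedMatrix_zero] at h2
  simp [fst_chart_perturb, snd_chart_perturb, hz, h3] at h2
  rw [snd_chart_perturb, snd_chart_perturb, ← hc]
  linear_combination -h2

theorem weight_zwt_nonneg (d : Fin 2 ⊕ Fin k →₀ ℕ) : 0 ≤ Finsupp.weight (zwt k) d := by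
  rw [weight_zwt]; positivity

theorem not_zVar_dvd_sVar (i : Fin k) : ¬ zVar K i ∣ sVar K k := by
  simp [sVar, zVar, X_dvd_X]

theorem not_zVar_dvd_tVar (i : Fin k) : ¬ zVar K i ∣ tVar K k := by
  simp [tVar, zVar, X_dvd_X]

theorem not_zVar_dvd_zVar {i j : Fin k} (h : i ≠ j) : ¬ zVar K i ∣ zVar K j := by
  simp [zVar, X_dvd_X, h]

/-- Once z^{(i)} divides c it can be cancelled, and s^{e_i} w is a multiple of P of degree below a
in the z's, so zero. If some z^{(i)} with e_i > 0 does not divide P, it must divide c because it is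
prime. Otherwise there are two indices with positive degree, and comparing their equations shows
that z^{(i)} divides c. -/
theorem eq_zero_of_row_mul_eq {a M : ℕ} {P w : CoxRing K k} (ha : 1 ≤ a) (hP : P ≠ 0)
    (hPz : IsWeightedHomogeneous (zwt k) P a)
    (hwz : IsWeightedHomogeneous (zwt k) w ((a - 1 : ℕ) : ℤ))
    (hw : ∀ i, 0 < e i → ∃ c, zVar K i * sVar K k ^ e i * w =
      sVar K k * tVar K k ^ M * (P * c))
    (hpos : ∃ i, 0 < e i)
    (hdvd : ∀ i, 0 < e i → (∀ j, j ≠ i → e j = 0) → ¬ zVar K i ∣ P) : w = 0 := by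
  have hs : sVar K k ≠ 0 := sVar_ne_zero
  have ht : tVar K k ≠ 0 := tVar_ne_zero
  have hzp : ∀ i : Fin k, Prime (zVar K i) := fun i => X_prime
  have hns : ∀ (i : Fin k) n, ¬ zVar K i ∣ sVar K k ^ n := fun i n h =>
    not_zVar_dvd_sVar i ((hzp i).dvd_of_dvd_pow h)
  have hnt : ∀ (i : Fin k) n, ¬ zVar K i ∣ tVar K k ^ n := fun i n h =>
    not_zVar_dvd_tVar i ((hzp i).dvd_of_dvd_pow h)
  obtain ⟨i, c, hc⟩ : ∃ i c, zVar K i * sVar K k ^ e i * w =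
      sVar K k * tVar K k ^ M * (P * (zVar K i * c)) := by
    by_cases hex : ∃ i, 0 < e i ∧ ¬ zVar K i ∣ P
    · obtain ⟨i, hi, hiP⟩ := hex
      obtain ⟨c, hc⟩ := hw i hi
      have h1 : zVar K i ∣ sVar K k * tVar K k ^ M * (P * c) :=
        ⟨_, hc.symm.trans (mul_assoc _ _ _)⟩
      obtain ⟨c, rfl⟩ : zVar K i ∣ c := by
        rcases (hzp i).dvd_or_dvd h1 with h | h
        · rcases (hzp i).dvd_or_dvd h with h | h
          · exact absurd h (not_zVar_dvd_sVar i)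
          · exact absurd h (hnt i M)
        · exact ((hzp i).dvd_or_dvd h).resolve_left hiP
      exact ⟨i, c, hc⟩
    · push Not at hex
      obtain ⟨i, hi⟩ := hpos
      obtain ⟨j, hji, hj⟩ : ∃ j, j ≠ i ∧ e j ≠ 0 := by
        by_contra hcon
        push Not at hcon
        exact hdvd i hi hcon (hex i hi)
      obtain ⟨c, hc⟩ := hw i hi
      obtain ⟨c', hc'⟩ := hw j (Nat.pos_of_ne_zero hj)
      have h1 : zVar K i * (sVar K k ^ e i * c') = zVar K j * (sVar K k ^ e j * c) := by
        refine mul_left_cancel₀ (mul_ne_zero (mul_ne_zero hs (pow_ne_zero M ht)) hP) ?_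
        linear_combination zVar K j * sVar K k ^ e j * hc - zVar K i * sVar K k ^ e i * hc'
      obtain ⟨c, rfl⟩ : zVar K i ∣ c := by
        rcases (hzp i).dvd_or_dvd ⟨_, h1.symm⟩ with h | h
        · exact absurd h (not_zVar_dvd_zVar hji.symm)
        · exact ((hzp i).dvd_or_dvd h).resolve_left (hns i _)
      exact ⟨i, c, hc⟩
  have h1 : (sVar K k * tVar K k ^ M * c) * P = sVar K k ^ e i * w := by
    refine mul_left_cancel₀ (hzp i).ne_zero ?_
    linear_combination -hc
  have h2 : IsWeightedHomogeneous (zwt k) ((sVar K k * tVar K k ^ M * c) * P)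
      ((a - 1 : ℕ) : ℤ) := by
    rw [h1]
    convert (isWeightedHomogeneous_sVar_pow (zwt k) (e i)).mul hwz using 1
    simp [zwt]
  have h3 := mul_eq_zero_of_isWeightedHomogeneous_lt (zwt k) weight_zwt_nonneg hPz h2 (by omega)
  rw [h1] at h3
  exact (mul_eq_zero.1 h3).resolve_left (pow_ne_zero _ hs)

theorem chart_rolling_of_isDeformation {a b M : ℕ} (ha : 1 ≤ a) (hM : ∀ i, e i ≤ M)
    {p : (Fin k → ℕ) → ℕ → K} (hP : divisorEq e a b p ≠ 0)
    {Pm Pm' : Fin (b + 1) → MvPolynomial (ScrollVar e) K}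
    (hPm : IsRollingEquations e a b (divisorEq e a b p) Pm) {ζ : Fin k → ℕ → K}
    (hdvd : ∀ i, 0 < e i → (∀ j, j ≠ i → e j = 0) → ¬ zVar K i ∣ divisorEq e a b p)
    (hdef : IsDeformation e a ζ Pm Pm') (m : Fin b) :
    TrivSqZeroExt.inl (sVar K k) *
          chart e (tVar K k ^ M) (chartT e M ζ) (perturb (Pm m.succ) (Pm' m.succ)) =
        TrivSqZeroExt.inl (tVar K k) *
          chart e (tVar K k ^ M) (chartT e M ζ) (perturb (Pm m.castSucc) (Pm' m.castSucc)) := by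
  -- Here b > 0; without columns the rolling format would make P_m zero, contradicting P ≠ 0.
  have hpos : ∃ i, 0 < e i := by
    by_contra hcon
    push Not at hcon
    obtain ⟨q, hq, -⟩ := hPm.rolling m
    have : IsEmpty (ScrollCol e) := ⟨fun α => by
      have := α.2.2
      have := hcon α.1
      omega⟩
    rw [Finset.univ_eq_empty, Finset.sum_empty] at hq
    have h := hPm.represents m.castSucc
    rw [hq, map_zero] at h
    exact mul_ne_zero (mul_ne_zero (pow_ne_zero _ sVar_ne_zero) (pow_ne_zero _ tVar_ne_zero)) hP
      h.symm
  have hhom : ∀ m, IsWeightedHomogeneous (zwt k)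
      (chart e (tVar K k ^ M) (chartT e M ζ) (perturb (Pm m) (Pm' m))).snd
      ((a - 1 : ℕ) : ℤ) := by
    intro m
    rw [snd_chart_perturb]
    refine IsWeightedHomogeneous.add ?_ ?_
    · refine isWeightedHomogeneous_zwt_derivAlong (fun v => ?_) (hPm.homogeneous m)
      simpa [zwt] using isWeightedHomogeneous_chartT ζ hM (zwt k) rfl v
    · convert (isWeightedHomogeneous_tVar_pow (zwt k) M).mul
        (isWeightedHomogeneous_zwt_param e (hdef.1 m)) using 1
      simp [zwt]
  have hw := eq_zero_of_row_mul_eq (e := e) (M := M) ha hP (isWeightedHomogeneous_zwt_divisorEq a b p)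
    (w := sVar K k *
        (chart e (tVar K k ^ M) (chartT e M ζ) (perturb (Pm m.succ) (Pm' m.succ))).snd -
      tVar K k *
        (chart e (tVar K k ^ M) (chartT e M ζ) (perturb (Pm m.castSucc) (Pm' m.castSucc))).snd)
    (by
      refine IsWeightedHomogeneous.sub ?_ ?_
      · convert (isWeightedHomogeneous_sVar_pow (zwt k) 1).mul (hhom m.succ) using 1
        · rw [pow_one]
        simp [zwt]
      · convert (isWeightedHomogeneous_tVar_pow (zwt k) 1).mul (hhom m.castSucc) using 1
        · rw [pow_one]
        simp [zwt])
    (fun i hi => by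
      -- The first column of block i is used: its top entry maps to z^{(i)} s^{e_i}, without any
      -- factor t.
      obtain ⟨c, hc⟩ := exists_row_mul_eq hPm hdef (isChart_chartT ζ hM) m ⟨i, ⟨0, hi⟩⟩
      refine ⟨c, ?_⟩
      rw [← hc]
      simp [scrollMatrix, param_X])
    hpos hdvd
  apply dualNumber_ext
  · simp only [DualNumber, TrivSqZeroExt.fst_mul, TrivSqZeroExt.fst_inl, fst_chart_perturb,
      hPm.represents, Fin.val_succ, Fin.val_castSucc]
    rw [show b - (m : ℕ) = b - (m + 1) + 1 by have := m.2; omega]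
    ring
  · simpa using sub_eq_zero.1 hw

theorem chart_rolling_of_isRolling {b : ℕ} {ζ : Fin k → ℕ → K} {u : CoxRing K k}
    {d : ScrollVar e → CoxRing K k} (hd : IsChart e ζ u d)
    {Q : Fin (b + 1) → MvPolynomial (ScrollVar e) (DualNumber K)}
    (hQ : IsRolling (deformedMatrix e ζ) Q) (m : Fin b) :
    TrivSqZeroExt.inl (sVar K k) * chart e u d (Q m.succ) =
      TrivSqZeroExt.inl (tVar K k) * chart e u d (Q m.castSucc) := by
  obtain ⟨q, hq0, hq1⟩ := hQ m
  rw [hq0, hq1, map_sum, map_sum, Finset.mul_sum, Finset.mul_sum]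
  refine Finset.sum_congr rfl fun α _ => ?_
  rw [map_mul, map_mul]
  linear_combination chart e u d (q α) * chart_rows hd α

theorem liftingMatrix_mulVec {a b : ℕ} (p : (Fin k → ℕ) → ℕ → K) {ζ : Fin k → ℕ → K}
    (hζ : ∀ i j, j = 0 ∨ e i ≤ j → ζ i j = 0) (r : LiftingRow e a b) :
    (liftingMatrix e a b p).mulVec (fun c => ζ c.1 ((c.2 : ℕ) + 1)) r =
      liftingForm e b p ζ r.1.1 r.1.2 := by
  have hn := r.2.2.2.1
  rw [Matrix.mulVec, dotProduct, Fintype.sum_sigma, liftingForm]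
  refine Finset.sum_congr rfl fun l _ => ?_
  simp only [liftingMatrix, Matrix.of_apply, Finset.sum_mul, ite_mul, zero_mul]
  rw [Finset.sum_comm]
  refine Finset.sum_congr rfl fun j _ => ?_
  by_cases hj : j + r.1.2 < e l
  · rw [Finset.sum_eq_single (⟨j + r.1.2 - 1, by omega⟩ : Fin (e l - 1))]
    · simp only
      rw [if_pos (by omega), Nat.sub_add_cancel (by omega)]
    · intro c _ hc
      refine if_neg fun h => hc (Fin.ext ?_)
      simp only
      omega
    · simp
  -- Terms of the lifting form with j + n ≥ e_l have no column in the matrix; there ζ is zero by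
  -- convention.
  · rw [hζ l _ (Or.inr (not_lt.1 hj)), mul_zero]
    refine Finset.sum_eq_zero fun c _ => if_neg ?_
    have := c.2
    omega

end Necessity

end RollingFactors

/-! ### The theorem. -/

theorem proposition2p11 {K : Type*} [Field K] {k : ℕ} (e : Fin k → ℕ) (a b : ℕ) (ha : 2 ≤ a)
    -- the divisor of type `aH - bR`, with coefficients `p_{I,j}`
    (p : (Fin k → ℕ) → ℕ → K) (hP : RollingFactors.divisorEq e a b p ≠ 0)
    -- its rolling factors equations `P_0, …, P_b`
    (Pm : Fin (b + 1) → MvPolynomial (RollingFactors.ScrollVar e) K)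
    (hPm : RollingFactors.IsRollingEquations e a b (RollingFactors.divisorEq e a b p) Pm)
    -- the deformation variables; `ζ^{(i)}_j` is zero unless `0 < j < e_i`
    (ζ : Fin k → ℕ → K) (hζ : ∀ i j, j = 0 ∨ e i ≤ j → ζ i j = 0) :
    (RollingFactors.LiftsRolling e a ζ Pm ↔
      ∀ I : Fin k → ℕ, ∑ l, I l = a - 1 → RollingFactors.pairing e I < b - 1 →
        ∀ n : ℕ, 0 < n → n < b - RollingFactors.pairing e I →
          RollingFactors.liftingForm e b p ζ I n = 0) ∧
    -- every lift counts, unless `z^{(i)}` divides `P` for the only `i` with `e_i > 0`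
    ((∀ i, 0 < e i → (∀ j, j ≠ i → e j = 0) →
        ¬ RollingFactors.zVar K i ∣ RollingFactors.divisorEq e a b p) →
      (RollingFactors.Lifts e a ζ Pm ↔
        ∀ I : Fin k → ℕ, ∑ l, I l = a - 1 → RollingFactors.pairing e I < b - 1 →
          ∀ n : ℕ, 0 < n → n < b - RollingFactors.pairing e I →
            RollingFactors.liftingForm e b p ζ I n = 0)) ∧
    -- the coefficient matrix of the system of linear equations is the lifting matrix
    (∀ r : RollingFactors.LiftingRow e a b,
      (RollingFactors.liftingMatrix e a b p).mulVec (fun c => ζ c.1 ((c.2 : ℕ) + 1)) r =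
        RollingFactors.liftingForm e b p ζ r.1.1 r.1.2) := by

  have hM : ∀ i, e i ≤ b + ∑ i, e i := fun i =>
    (Finset.single_le_sum (fun _ _ => Nat.zero_le _) (Finset.mem_univ i)).trans
      (Nat.le_add_left _ _)
  have ha' : 1 ≤ a := by omega
  refine ⟨⟨?_, RollingFactors.exists_deformation ha' hP hPm⟩, fun hdvd => ⟨?_, fun hL => ?_⟩,
    RollingFactors.liftingMatrix_mulVec p hζ⟩
  · rintro ⟨Pm', -, hroll⟩ I hI - n hn hnb
    exact RollingFactors.liftingForm_eq_zero_of_chart ha' hM (Nat.le_add_right _ _) hPm Pm'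
      (RollingFactors.chart_rolling_of_isRolling
        (Q := fun m => RollingFactors.perturb (Pm m) (Pm' m))
        (RollingFactors.isChart_chartT ζ hM) hroll)
      hI hn hnb
  · rintro ⟨Pm', hdef⟩ I hI - n hn hnb
    exact RollingFactors.liftingForm_eq_zero_of_chart ha' hM (Nat.le_add_right _ _) hPm Pm'
      (RollingFactors.chart_rolling_of_isDeformation ha' hM hP hPm hdvd hdef) hI hn hnb
  · exact (RollingFactors.exists_deformation ha' hP hPm hL).imp fun _ h => h.1
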